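/- **Setting.** Let $d,N\ge 1$, $\mathbb T^d_N=\mathbb Z^d/N\mathbb Z^d$, and let $r(x,x+e)>0$ be jump rates attached to the directed edges $(x,e)$, $x\in\mathbb T^d_N$, $e\in\mathbb Z^d$, $|e|=1$ (sums over $e$ below run over the $2d$ vectors $\pm e_1,\dots,\pm e_d$; for $N\le 2$ edges with different directions may share their endpoints). Let $\pi$ be the invariant distribution of the random walk with rates $r$, $\pi[f]=\sum_x\pi(x)f(x)$, $\langle f,h\rangle=\sum_x\pi(x)\overline{f(x)}h(x)$, let $r^*(x,x+e)=\pi(x+e)\,r(x+e,x)/\pi(x)$ be the time-reversed rates (where $r(x+e,x)$ is the rate of the jump $-e$ from $x+e$), and let $$\mathcal Lf(x)=\sum_{e}r(x,x+e)[f(x+e)-f(x)],\qquad \mathcal L^*f(x)=\sum_{e}r^*(x,x+e)[f(x+e)-f(x)]$$ be the generator and its adjoint in $L^2(\pi)$. Put $$c_j(x)=r(x,x+e_j)+r(x,x-e_j),\quad \gamma_j(x)=r(x,x+e_j)-r(x,x-e_j),\quad \Psi(x)=-\sum_{e}\bigl(r^*(x,x+e)+r(x,x+e)\bigr)e .$$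 Fix $\omega\in\mathbb R\setminus\{0\}$ and a unit vector $v\in\mathbb R^d$. For $\lambda\in\mathbb R$ let $(X^\lambda_t)_{t\ge0}$ be the random walk on $\mathbb T^d_N$ which at time $t$ jumps from $x$ to $x+e$ with rate $r^\lambda_t(x,x+e)=e^{\lambda\cos(\omega t)\,e\cdot v}\,r(x,x+e)$, in its oscillatory steady state: the initial distribution is the one, $\pi_\lambda$, that is left invariant by the evolution over one period $2\pi/|\omega|$ (here $\pi$ is the number). Let $(Y^\lambda_t)_{t\ge0}$ be the lift of $(X^\lambda_t)$ to $\mathbb Z^d$ (with any integrable lift $Y^\lambda_0$ of $X^\lambda_0$). **Theorem.** (i) For all $\lambda\in\mathbb R$ and $t\ge0$, $Y^\lambda_t$ is integrable and the mean instantaneous velocity $V_\lambda(t):=\frac{d}{dt}E[Y^\lambda_t]$ (one-sided at $t=0$) exists and equals $\sum_{e}E\bigl[r^\lambda_t(X^\lambda_t,X^\lambda_t+e)\bigr]e$. For every $t\ge0$ the map $\lambda\mapsto V_\lambda(t)$ is differentiable at $\lambda=0$ and $$\partial_{\lambda=0}V_\lambda(t)=\Re\bigl(e^{i\omega t}\sigma(\omega)v\bigr),$$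 where the operator $i\omega-\mathcal L^*$ is invertible and $\sigma(\omega)$ is the complex $d\times d$ matrix (not depending on $v$, $t$) $$\sigma_{jk}(\omega)=\pi[c_j]\,\delta_{jk}+\langle\gamma_j,(i\omega-\mathcal L^*)^{-1}\Psi_k\rangle=\pi[c_j]\,\delta_{jk}+\int_0^{\infty}\langle\gamma_j,e^{-(i\omega-\mathcal L^*)s}\Psi_k\rangle\,ds ,$$ the last integral being absolutely convergent. (ii) If the walk is reversible, i.e. $r^*(x,x+e)=r(x,x+e)$ for all $x,e$, then $\Psi=-2\gamma$, $\mathcal L^*=\mathcal L$, the matrix $\sigma(\omega)$ is symmetric, and $$\sigma_{jk}(\omega)=\pi[c_j]\,\delta_{jk}-2\langle\gamma_j,(i\omega-\mathcal L)^{-1}\gamma_k\rangle=\pi[c_j]\,\delta_{jk}-2\int_0^{\infty}\langle\gamma_j,e^{-(i\omega-\mathcal L)s}\gamma_k\rangle\,ds ,$$ with absolutely convergent integrals. -/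

import Mathlib

open MeasureTheory ProbabilityTheory Set Filter Topology
open scoped NNReal Matrix

namespace TorusWalk

/-- The discrete torus `ℤ^d / N ℤ^d`. -/
abbrev Torus (d N : ℕ) := Fin d → ZMod N

/-- The `2d` directions `e ∈ ℤ^d`, `|e| = 1`: the pair `(j, s)` stands for `s e_j`, `s = ±1`. -/
abbrev Direction (d : ℕ) := Fin d × ℤˣ

/-- The unit vector of `ℤ^d` in a given direction. -/
def Direction.vec {d : ℕ} (e : Direction d) : Fin d → ℤ := Pi.single e.1 (e.2 : ℤ)

/-- The opposite direction `-e`. -/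
def Direction.opp {d : ℕ} (e : Direction d) : Direction d := (e.1, -e.2)

/-- The Euclidean scalar product `e · v`. -/
def Direction.dot {d : ℕ} (e : Direction d) (v : Fin d → ℝ) : ℝ :=
  ∑ i, (e.vec i : ℝ) * v i

/-- The projection `ℤ^d → ℤ^d / N ℤ^d`. -/
def proj {d : ℕ} (N : ℕ) (y : Fin d → ℤ) : Torus d N := fun i => (y i : ZMod N)

/-- The neighbour `x + e` of `x` on the torus. -/
def nbr {d N : ℕ} (x : Torus d N) (e : Direction d) : Torus d N := x + proj N e.vec

/-- Nearest-neighbour jump rates: `r x e` is the rate `r(x, x + e)`. A rate is attached to every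
directed edge; for `N ≥ 3` these are the ordered pairs of neighbouring points. -/
abbrev Rates (d N : ℕ) := Torus d N → Direction d → ℝ

variable {d N : ℕ}

/-- `p` is an invariant probability distribution for the walk with rates `r`. -/
structure IsInvariant [NeZero N] (r : Rates d N) (p : Torus d N → ℝ) : Prop where
  nonneg : ∀ x, 0 ≤ p x
  sum_eq_one : ∑ x, p x = 1
  balance : ∀ x, p x * ∑ e, r x e = ∑ e : Direction d, p (nbr x e) * r (nbr x e) e.opp

/-- The time-reversed rates `r*(x, x + e) = p(x + e) r(x + e, x) / p(x)`. -/
noncomputable def reversed (r : Rates d N) (p : Torus d N → ℝ) : Rates d N :=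
  fun x e => p (nbr x e) * r (nbr x e) e.opp / p x

/-- The walk is reversible with respect to `p` when `r* = r`. -/
def IsReversible (r : Rates d N) (p : Torus d N → ℝ) : Prop := reversed r p = r

/-- The generator `f ↦ ∑_e r(x, x + e) (f(x + e) - f(x))` on complex functions. -/
noncomputable def generator [NeZero N] (r : Rates d N) :
    (Torus d N → ℂ) →L[ℂ] (Torus d N → ℂ) :=
  LinearMap.toContinuousLinearMap
    { toFun := fun f x => ∑ e, (r x e : ℂ) * (f (nbr x e) - f x)
      map_add' := by
        intro f g
        funext x
        simp only [Pi.add_apply, ← Finset.sum_add_distrib]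
        exact Finset.sum_congr rfl fun e _ => by ring
      map_smul' := by
        intro a f
        funext x
        simp only [Pi.smul_apply, smul_eq_mul, RingHom.id_apply, Finset.mul_sum]
        exact Finset.sum_congr rfl fun e _ => by ring }

/-- The adjoint of `generator r` in `L²(p)`, given by the time-reversed rates. -/
noncomputable def adjGenerator [NeZero N] (r : Rates d N) (p : Torus d N → ℝ) :
    (Torus d N → ℂ) →L[ℂ] (Torus d N → ℂ) :=
  generator (reversed r p)

/-- The scalar product of `L²(p)`, conjugate linear in the first argument. -/
noncomputable def scal [NeZero N] (p : Torus d N → ℝ) (f h : Torus d N → ℂ) : ℂ :=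
  ∑ x, (p x : ℂ) * (starRingEnd ℂ (f x) * h x)

/-- `c_j(x) = r(x, x + e_j) + r(x, x - e_j)`. -/
def cFun (r : Rates d N) (j : Fin d) (x : Torus d N) : ℝ := r x (j, 1) + r x (j, -1)

/-- `γ_j(x) = r(x, x + e_j) - r(x, x - e_j)`. -/
def gammaFun (r : Rates d N) (j : Fin d) (x : Torus d N) : ℝ := r x (j, 1) - r x (j, -1)

/-- `Ψ_k(x)`, where `Ψ(x) = - ∑_e (r*(x, x + e) + r(x, x + e)) e`. -/
noncomputable def psiFun (r : Rates d N) (p : Torus d N → ℝ) (k : Fin d) (x : Torus d N) : ℝ :=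
  -∑ e : Direction d, (reversed r p x e + r x e) * (e.vec k : ℝ)

/-- A real function on the torus, seen as a complex one. -/
def toC (f : Torus d N → ℝ) : Torus d N → ℂ := fun x => (f x : ℂ)

/-- The complex mobility matrix
`σ_{jk}(ω) = p[c_j] δ_{jk} + ⟨γ_j, (iω - L*)⁻¹ Ψ_k⟩`. -/
noncomputable def mobility [NeZero N] (r : Rates d N) (p : Torus d N → ℝ) (ω : ℝ) :
    Matrix (Fin d) (Fin d) ℂ :=
  Matrix.of fun j k =>
    (if j = k then ((∑ x, p x * cFun r j x : ℝ) : ℂ) else 0)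
      + scal p (toC (gammaFun r j))
          (resolvent (adjGenerator r p) (Complex.I * (ω : ℂ)) (toC (psiFun r p k)))

/-- The integrand `⟨f, e^{-(iω - A) s} h⟩` for an operator `A`. -/
noncomputable def laplaceIntegrand [NeZero N] (p : Torus d N → ℝ)
    (A : (Torus d N → ℂ) →L[ℂ] (Torus d N → ℂ)) (ω : ℝ) (f h : Torus d N → ℂ) (s : ℝ) : ℂ :=
  scal p f
    (NormedSpace.exp (-((s : ℂ) • (algebraMap ℂ _ (Complex.I * (ω : ℂ)) - A))) h)

/-- The perturbed rates `r_t^l(x, x + e) = exp(l cos(ω t) e · v) r(x, x + e)`. -/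
noncomputable def perturbed (r : Rates d N) (ω : ℝ) (v : Fin d → ℝ) (l t : ℝ) : Rates d N :=
  fun x e => Real.exp (l * Real.cos (ω * t) * e.dot v) * r x e

/-- The generator at time `t` of the perturbed walk lifted to `ℤ^d`. -/
noncomputable def liftedGenerator (r : Rates d N) (ω : ℝ) (v : Fin d → ℝ) (l t : ℝ)
    (f : (Fin d → ℤ) → ℝ) (y : Fin d → ℤ) : ℝ :=
  ∑ e : Direction d, perturbed r ω v l t (proj N y) e * (f (y + e.vec) - f y)

/-- `Y` is (the lift to `ℤ^d` of) the perturbed random walk: a càdlàg process which is a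
time-inhomogeneous Markov jump process jumping from `y` to `y + e` at time `t` with rate
`r_t^l(y, y + e)`, where `y` is read modulo `N`. The law of the process is
specified by its martingale problem (the rates are bounded). -/
structure IsLiftedWalk (r : Rates d N) (ω : ℝ) (v : Fin d → ℝ) (l : ℝ)
    {Ω : Type*} [mΩ : MeasurableSpace Ω] (P : Measure Ω) (Y : ℝ≥0 → Ω → Fin d → ℤ) : Prop where
  right_continuous : ∀ a t, ContinuousWithinAt (fun s => Y s a) (Ici t) t
  left_limits : ∀ a t, ∃ y, Tendsto (fun s => Y s a) (𝓝[<] t) (𝓝 y)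
  martingale_problem : ∃ ℱ : Filtration ℝ≥0 mΩ, (∀ t, Measurable[ℱ t] (Y t)) ∧
    ∀ f : (Fin d → ℤ) → ℝ, (∃ C, ∀ y, |f y| ≤ C) →
      Martingale (fun (t : ℝ≥0) a => f (Y t a)
        - ∫ s in (0 : ℝ)..t, liftedGenerator r ω v l s f (Y s.toNNReal a)) ℱ P

/-- The perturbed walk in its oscillatory steady state: the torus walk `X_t = Y_t mod N` starts
from a distribution that is left invariant by the evolution over one period `2π / |ω|`. The
starting point in `ℤ^d` may be any integrable lift of `X_0`. -/
structure IsOscillatorySteadyState (r : Rates d N) (ω : ℝ) (v : Fin d → ℝ) (l : ℝ)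
    {Ω : Type*} [MeasurableSpace Ω] (P : Measure Ω) (Y : ℝ≥0 → Ω → Fin d → ℤ) : Prop where
  walk : IsLiftedWalk r ω v l P Y
  integrable_start : ∀ j, Integrable (fun a => (Y 0 a j : ℝ)) P
  periodic : ∀ x : Torus d N,
    P {a | proj N (Y (2 * Real.pi / |ω|).toNNReal a) = x} = P {a | proj N (Y 0 a) = x}

/-- The mean position `E[Y_t]`, for `t ≥ 0`. -/
noncomputable def meanPosition {Ω : Type*} [MeasurableSpace Ω] (P : Measure Ω)
    (Y : ℝ≥0 → Ω → Fin d → ℤ) (t : ℝ) : Fin d → ℝ :=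
  fun j => ∫ a, (Y t.toNNReal a j : ℝ) ∂P

/-- The mean instantaneous velocity `d/dt E[Y_t]` (one-sided at `t = 0`). -/
noncomputable def meanVelocity {Ω : Type*} [MeasurableSpace Ω] (P : Measure Ω)
    (Y : ℝ≥0 → Ω → Fin d → ℤ) (t : ℝ) : Fin d → ℝ :=
  derivWithin (meanPosition P Y) (Ici 0) t

end TorusWalk

/-!
Let `p` be the invariant distribution, `L*` the adjoint generator in `L²(p)` and `f_t` the density
with respect to `p` of the law of the perturbed walk. The forward equation becomes
`∂_t f = L* f + F_t f`, where the forcing `F_t` is of order `λ` and `F_t 1 = λ cos(ωt) Ψ·v + O(λ²)`.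

The walk is irreducible, so `L*` has a spectral gap on the functions of mean zero: there the energy
`‖h‖²` of a solution of `∂_t h = L* h + g` relaxes exponentially to the size of `g`, and a periodic
solution is bounded by its forcing at all times. Applied to `h = f - 1`, this gives `f - 1 = O(λ)`.
The periodic function `u_t = Re (e^{iωt} (iω - L*)⁻¹ Ψ·v)` solves `∂_t u = L* u + cos(ωt) Ψ·v`, so
the same bound applied to `h = f - 1 - λ u`, whose forcing is `O(λ²)`, identifies `u` as the
derivative of the density at `λ = 0`.

By Dynkin's formula the mean velocity in the direction `e_j` is the average under the law of the
walk of `γ_j` for the perturbed rates. Its derivative has two parts: that of the rates gives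
`cos(ωt) p[c_j] v_j`, that of the law gives `p[u_t γ_j]`. The spectral gap also makes
`e^{-(iω - L*)s} Ψ_k` decay exponentially, which turns the resolvent into a Laplace transform.
-/

namespace TorusWalk

variable {d N : ℕ}

section Directions

theorem Direction.opp_opp (e : Direction d) : e.opp.opp = e := by
  simp [Direction.opp]

theorem Direction.vec_opp (e : Direction d) : e.opp.vec = -e.vec := by
  simp [Direction.opp, Direction.vec, ← Pi.single_neg]

theorem Direction.dot_eq_sign_mul (e : Direction d) (v : Fin d → ℝ) :
    e.dot v = ((e.2 : ℤ) : ℝ) * v e.1 := by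
  simp [Direction.dot, Direction.vec, Pi.single_apply]

theorem Direction.dot_opp (e : Direction d) (v : Fin d → ℝ) : e.opp.dot v = -e.dot v := by
  simp [Direction.dot_eq_sign_mul, Direction.opp]

theorem Direction.abs_dot_le (e : Direction d) (v : Fin d → ℝ) : |e.dot v| ≤ ‖v‖ := by
  have habs : |e.dot v| = ‖v e.1‖ := by
    rcases Int.units_eq_one_or e.2 with h | h <;> simp [Direction.dot_eq_sign_mul, h]
  exact habs.trans_le (norm_le_pi_norm v e.1)

theorem Direction.abs_vec_le_one (e : Direction d) (j : Fin d) : |(e.vec j : ℝ)| ≤ 1 := by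
  by_cases hj : j = e.1
  · subst hj
    rcases Int.units_eq_one_or e.2 with h | h <;> simp [Direction.vec, h]
  · simp [Direction.vec, Pi.single_eq_of_ne hj]

theorem sum_direction {A : Type*} [AddCommMonoid A] (F : Direction d → A) :
    ∑ e, F e = ∑ j, (F (j, 1) + F (j, -1)) := by
  rw [Fintype.sum_prod_type]
  refine Finset.sum_congr rfl fun j _ => ?_
  rw [show (Finset.univ : Finset ℤˣ) = {1, -1} from rfl, Finset.sum_pair (by decide)]

theorem sum_mul_vec (q : Rates d N) (x : Torus d N) (j : Fin d) :
    ∑ e, q x e * (e.vec j : ℝ) = gammaFun q j x := by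
  rw [sum_direction, Finset.sum_eq_single_of_mem j (Finset.mem_univ _)]
  · simp [gammaFun, Direction.vec, sub_eq_add_neg]
  · intro i _ hij
    simp [Direction.vec, Pi.single_eq_of_ne hij.symm]

theorem proj_add (y z : Fin d → ℤ) : proj N (y + z) = proj N y + proj N z := by
  funext i
  simp [proj]

theorem nbr_nbr_opp (x : Torus d N) (e : Direction d) : nbr (nbr x e) e.opp = x := by
  rw [nbr, nbr, add_assoc, ← proj_add, Direction.vec_opp, add_neg_cancel]
  funext i
  simp [proj]

/-- Reversal of the directed edges: `(x, e) ↦ (x + e, -e)`. -/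
def edgeReversal : Torus d N × Direction d ≃ Torus d N × Direction d where
  toFun a := (nbr a.1 a.2, a.2.opp)
  invFun a := (nbr a.1 a.2, a.2.opp)
  left_inv a := by simp only [nbr_nbr_opp, Direction.opp_opp]
  right_inv a := by simp only [nbr_nbr_opp, Direction.opp_opp]

variable {r : Rates d N} {p : Torus d N → ℝ}

theorem reversed_pos (hr : ∀ x e, 0 < r x e) (hp : ∀ x, 0 < p x) (x : Torus d N)
    (e : Direction d) : 0 < reversed r p x e :=
  div_pos (mul_pos (hp _) (hr _ _)) (hp x)

theorem mul_reversed (hp : ∀ x, 0 < p x) (x : Torus d N) (e : Direction d) :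
    p x * reversed r p x e = p (nbr x e) * r (nbr x e) e.opp :=
  mul_div_cancel₀ _ (hp x).ne'

end Directions

section Torus

variable [NeZero N]

theorem sum_edgeReversal {A : Type*} [AddCommMonoid A] (F : Torus d N → Direction d → A) :
    ∑ x, ∑ e : Direction d, F (nbr x e) e.opp = ∑ x, ∑ e, F x e := by
  rw [← Fintype.sum_prod_type', ← Fintype.sum_prod_type']
  exact Equiv.sum_comp edgeReversal fun a => F a.1 a.2

theorem forall_of_nbr {S : Torus d N → Prop} {x₀ : Torus d N} (h₀ : S x₀)
    (hnbr : ∀ x (e : Direction d), S x → S (nbr x e)) (x : Torus d N) : S x := by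
  let translations : AddSubmonoid (Torus d N) :=
    { carrier := {z | ∀ y, S y → S (y + z)}
      zero_mem' := fun y hy => by simpa using hy
      add_mem' := fun ha hb y hy => by simpa only [add_assoc] using hb _ (ha _ hy) }
  have single_eq (i : Fin d) : Pi.single i 1 = proj N (Direction.vec (i, 1)) := by
    funext k
    by_cases hk : k = i <;> simp [proj, Direction.vec, hk]
  have single_mem (i : Fin d) : Pi.single i 1 ∈ translations := fun y hy => by
    rw [single_eq]
    exact hnbr y (i, 1) hy
  have mem : x - x₀ ∈ translations := by
    rw [← Finset.univ_sum_single (x - x₀)]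
    refine sum_mem fun i _ => ?_
    simpa only [← Pi.single_smul, nsmul_one, ZMod.natCast_zmod_val] using
      nsmul_mem (single_mem i) ((x - x₀) i).val
  simpa using mem x₀ h₀

theorem sum_by_parts {R : Type*} [CommRing R] (q : Torus d N → Direction d → R)
    (μ g : Torus d N → R) :
    ∑ x, μ x * ∑ e, q x e * (g (nbr x e) - g x) =
      ∑ x, (∑ e : Direction d, μ (nbr x e) * q (nbr x e) e.opp - μ x * ∑ e, q x e) * g x := by
  have hflux : ∑ x, ∑ e, μ x * q x e * g (nbr x e) =
      ∑ x, ∑ e : Direction d, μ (nbr x e) * q (nbr x e) e.opp * g x := by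
    simpa only [nbr_nbr_opp] using
      (sum_edgeReversal fun x (e : Direction d) => μ x * q x e * g (nbr x e)).symm
  simp only [sub_mul, Finset.sum_sub_distrib, Finset.sum_mul, Finset.mul_sum, mul_sub,
    ← mul_assoc, hflux]

variable {r : Rates d N} {p : Torus d N → ℝ}

theorem IsInvariant.pos (hr : ∀ x e, 0 < r x e) (hp : IsInvariant r p) (x : Torus d N) :
    0 < p x := by
  refine (hp.nonneg x).lt_of_ne' fun hx => ?_
  have hzero : ∀ y, p y = 0 := forall_of_nbr hx fun y e hy => by
    have hflux : ∑ e : Direction d, p (nbr y e) * r (nbr y e) e.opp = 0 := by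
      rw [← hp.balance y, hy, zero_mul]
    have hterm := (Finset.sum_eq_zero_iff_of_nonneg fun e _ =>
      mul_nonneg (hp.nonneg _) (hr _ _).le).1 hflux e (Finset.mem_univ _)
    exact (mul_eq_zero.1 hterm).resolve_right (hr _ _).ne'
  simpa [hzero] using hp.sum_eq_one

theorem IsInvariant.sum_reversed (hp₀ : ∀ x, 0 < p x) (hp : IsInvariant r p) (x : Torus d N) :
    ∑ e, reversed r p x e = ∑ e, r x e := by
  refine mul_left_cancel₀ (hp₀ x).ne' ?_
  rw [hp.balance x, Finset.mul_sum]
  exact Finset.sum_congr rfl fun e _ => mul_reversed hp₀ x e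

theorem IsInvariant.reversed (hp₀ : ∀ x, 0 < p x) (hp : IsInvariant r p) :
    IsInvariant (reversed r p) p where
  nonneg := hp.nonneg
  sum_eq_one := hp.sum_eq_one
  balance x := by
    rw [hp.sum_reversed hp₀, Finset.mul_sum]
    refine Finset.sum_congr rfl fun e _ => ?_
    rw [mul_reversed hp₀, nbr_nbr_opp, Direction.opp_opp]

end Torus

/-! ### Dirichlet form and spectral gap -/

section WeightedNorm

variable {ι : Type*} [Fintype ι] {w : ι → ℝ}

/-- The squared norm of `L²(w)`, for a weight `w` on a finite set. -/
noncomputable def normSq (w : ι → ℝ) (f : ι → ℂ) : ℝ := ∑ x, w x * ‖f x‖ ^ 2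

theorem normSq_nonneg (hw : ∀ x, 0 ≤ w x) (f : ι → ℂ) : 0 ≤ normSq w f :=
  Finset.sum_nonneg fun x _ => mul_nonneg (hw x) (sq_nonneg _)

theorem normSq_le_mul_norm_sq (hw : ∀ x, 0 ≤ w x) (f : ι → ℂ) :
    normSq w f ≤ (∑ x, w x) * ‖f‖ ^ 2 := by
  rw [normSq, Finset.sum_mul]
  gcongr with x
  exacts [hw x, norm_le_pi_norm f x]

theorem norm_sq_le_mul_normSq (hw : ∀ x, 0 < w x) (f : ι → ℂ) :
    ‖f‖ ^ 2 ≤ (∑ x, (w x)⁻¹) * normSq w f := by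
  have hinv : ∀ x ∈ Finset.univ, 0 ≤ (w x)⁻¹ := fun x _ => (inv_pos.2 (hw x)).le
  have hterm : ∀ x ∈ Finset.univ, 0 ≤ w x * ‖f x‖ ^ 2 := fun x _ =>
    mul_nonneg (hw x).le (sq_nonneg _)
  rw [← Real.le_sqrt (norm_nonneg f)
    (mul_nonneg (Finset.sum_nonneg hinv) (normSq_nonneg (fun x => (hw x).le) f)),
    pi_norm_le_iff_of_nonneg (Real.sqrt_nonneg _)]
  refine fun x => Real.le_sqrt_of_sq_le ?_
  calc ‖f x‖ ^ 2 = (w x)⁻¹ * (w x * ‖f x‖ ^ 2) := (inv_mul_cancel_left₀ (hw x).ne' _).symm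
    _ ≤ (∑ x, (w x)⁻¹) * normSq w f :=
      mul_le_mul (Finset.single_le_sum hinv (Finset.mem_univ x))
        (Finset.single_le_sum hterm (Finset.mem_univ x)) (hterm x (Finset.mem_univ x))
        (Finset.sum_nonneg hinv)

end WeightedNorm

section ScalarProduct

variable [NeZero N] {p : Torus d N → ℝ}

/-- The linear form `⟨f, ·⟩` of `L²(p)`. -/
noncomputable def scalCLM (p : Torus d N → ℝ) (f : Torus d N → ℂ) : (Torus d N → ℂ) →L[ℂ] ℂ :=
  ∑ x, ((p x : ℂ) * starRingEnd ℂ (f x)) • ContinuousLinearMap.proj x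

theorem scalCLM_apply (p : Torus d N → ℝ) (f h : Torus d N → ℂ) :
    scalCLM p f h = scal p f h := by
  simp [scalCLM, scal, mul_assoc]

/-- The mean `p[f] = ⟨1, f⟩`. -/
noncomputable def mean (p : Torus d N → ℝ) : (Torus d N → ℂ) →L[ℂ] ℂ := scalCLM p 1

theorem mean_apply (p : Torus d N → ℝ) (f : Torus d N → ℂ) : mean p f = ∑ x, (p x : ℂ) * f x := by
  simp [mean, scalCLM]

theorem scal_eq_mean (p : Torus d N → ℝ) (f h : Torus d N → ℂ) :
    scal p f h = mean p (star f * h) := by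
  simp [mean_apply, scal]

theorem re_scal (p : Torus d N → ℝ) (f h : Torus d N → ℂ) :
    (scal p f h).re = ∑ x, p x * (starRingEnd ℂ (f x) * h x).re := by
  rw [scal, Complex.re_sum]
  exact Finset.sum_congr rfl fun x _ => Complex.re_ofReal_mul _ _

theorem two_mul_re_scal_le (hp : ∀ x, 0 ≤ p x) (f h : Torus d N → ℂ) {ε : ℝ} (hε : 0 < ε) :
    2 * (scal p f h).re ≤ ε * normSq p f + ε⁻¹ * normSq p h := by
  simp only [re_scal, normSq, Finset.mul_sum, ← Finset.sum_add_distrib]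
  refine Finset.sum_le_sum fun x _ => ?_
  have hre : (starRingEnd ℂ (f x) * h x).re ≤ ‖f x‖ * ‖h x‖ :=
    (Complex.re_le_norm _).trans_eq (by rw [norm_mul, RCLike.norm_conj])
  have hyoung : 2 * (‖f x‖ * ‖h x‖) ≤ ε * ‖f x‖ ^ 2 + ε⁻¹ * ‖h x‖ ^ 2 := by
    have hsq : 0 ≤ ε⁻¹ * (ε * ‖f x‖ - ‖h x‖) ^ 2 := by positivity
    calc 2 * (‖f x‖ * ‖h x‖) ≤ 2 * (‖f x‖ * ‖h x‖) + ε⁻¹ * (ε * ‖f x‖ - ‖h x‖) ^ 2 := by linarith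
      _ = ε * ‖f x‖ ^ 2 + ε⁻¹ * ‖h x‖ ^ 2 := by field
  have hpoint : 2 * (starRingEnd ℂ (f x) * h x).re ≤ ε * ‖f x‖ ^ 2 + ε⁻¹ * ‖h x‖ ^ 2 := by
    linarith
  linarith [mul_le_mul_of_nonneg_left hpoint (hp x)]

theorem hasDerivAt_normSq (p : Torus d N → ℝ) {h : ℝ → Torus d N → ℂ} {h' : Torus d N → ℂ} {t : ℝ}
    (hh : HasDerivAt h h' t) :
    HasDerivAt (fun s => normSq p (h s)) (2 * (scal p (h t) h').re) t := by
  rw [re_scal, Finset.mul_sum]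
  refine HasDerivAt.fun_sum fun x _ => ?_
  refine ((hasDerivAt_pi.1 hh x).norm_sq.const_mul (p x)).congr_deriv ?_
  rw [Complex.inner, mul_left_comm, mul_comm (h' x)]

end ScalarProduct

section DirichletForm

variable [NeZero N] {r : Rates d N} {p : Torus d N → ℝ}

theorem generator_apply (r : Rates d N) (f : Torus d N → ℂ) (x : Torus d N) :
    generator r f x = ∑ e, (r x e : ℂ) * (f (nbr x e) - f x) := rfl

theorem generator_one (r : Rates d N) : generator r 1 = 0 := by
  funext x
  simp [generator_apply]

theorem mean_mul_generator (hp₀ : ∀ x, 0 < p x) (hp : IsInvariant r p) (f g : Torus d N → ℂ) :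
    mean p (f * generator r g) = mean p (generator (reversed r p) f * g) := by
  have hrev (x : Torus d N) (e : Direction d) :
      (p (nbr x e) : ℂ) * r (nbr x e) e.opp = p x * reversed r p x e := by
    exact_mod_cast (mul_reversed hp₀ x e).symm
  have hsum (x : Torus d N) : ∑ e, (reversed r p x e : ℂ) = ∑ e, (r x e : ℂ) := by
    exact_mod_cast hp.sum_reversed hp₀ x
  simp only [mean_apply, Pi.mul_apply, generator_apply, ← mul_assoc]
  rw [sum_by_parts (fun x e => (r x e : ℂ)) (fun x => (p x : ℂ) * f x)]
  refine Finset.sum_congr rfl fun x _ => ?_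
  simp only [mul_right_comm _ (f _), hrev, mul_sub, Finset.sum_sub_distrib, ← Finset.sum_mul,
    hsum, mul_assoc, ← Finset.mul_sum]

theorem mean_generator (hp₀ : ∀ x, 0 < p x) (hp : IsInvariant r p) (g : Torus d N → ℂ) :
    mean p (generator r g) = 0 := by
  simpa [generator_one] using mean_mul_generator hp₀ hp 1 g

theorem mean_psiFun (hp₀ : ∀ x, 0 < p x) (k : Fin d) : mean p (toC (psiFun r p k)) = 0 := by
  have hrev : ∑ x, ∑ e : Direction d, p x * reversed r p x e * (e.vec k : ℝ) =
      -∑ x, ∑ e : Direction d, p x * r x e * (e.vec k : ℝ) := by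
    rw [← sum_edgeReversal fun x (e : Direction d) => p x * r x e * (e.vec k : ℝ)]
    simp only [mul_reversed hp₀, Direction.vec_opp, Pi.neg_apply, Int.cast_neg, mul_neg,
      Finset.sum_neg_distrib, neg_neg]
  have hreal : ∑ x, p x * psiFun r p k x = 0 := by
    simp only [psiFun, mul_neg, Finset.mul_sum, add_mul, ← mul_assoc, Finset.sum_add_distrib,
      mul_add, Finset.sum_neg_distrib, hrev, neg_add_cancel, neg_zero]
  simp only [mean_apply, toC]
  exact_mod_cast hreal

/-- The discrete gradient `(x, e) ↦ f(x + e) - f(x)`. -/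
def gradient : (Torus d N → ℂ) →ₗ[ℂ] (Torus d N × Direction d → ℂ) where
  toFun f a := f (nbr a.1 a.2) - f a.1
  map_add' f g := by
    funext a
    simp only [Pi.add_apply]
    ring
  map_smul' c f := by
    funext a
    simp only [Pi.smul_apply, smul_eq_mul, RingHom.id_apply]
    ring

theorem eq_of_gradient_eq_zero {f : Torus d N → ℂ} (hf : gradient f = 0) (x y : Torus d N) :
    f x = f y :=
  forall_of_nbr (S := fun z => f z = f y) rfl
    (fun z e hz => (sub_eq_zero.1 (congrFun hf (z, e))).trans hz) x

/-- Twice the Dirichlet form: `∑ p(x) r(x, x + e) |f(x + e) - f(x)|²`. -/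
noncomputable def dirichlet (r : Rates d N) (p : Torus d N → ℝ) (f : Torus d N → ℂ) : ℝ :=
  normSq (fun a : Torus d N × Direction d => p a.1 * r a.1 a.2) (gradient f)

theorem two_mul_re_scal_generator (hp₀ : ∀ x, 0 < p x) (hp : IsInvariant r p)
    (f : Torus d N → ℂ) : 2 * (scal p f (generator r f)).re = -dirichlet r p f := by
  have hbalance : ∑ x, ∑ e, p x * (r x e * (‖f (nbr x e)‖ ^ 2 - ‖f x‖ ^ 2)) = 0 := by
    have := mean_generator hp₀ hp (fun x => ((‖f x‖ ^ 2 : ℝ) : ℂ))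
    simp only [mean_apply, generator_apply, Finset.mul_sum] at this
    exact_mod_cast this
  have polarization (a b : ℂ) :
      2 * (starRingEnd ℂ a * (b - a)).re = ‖b‖ ^ 2 - ‖a‖ ^ 2 - ‖b - a‖ ^ 2 := by
    simp only [Complex.sq_norm, Complex.normSq_apply, Complex.mul_re, Complex.conj_re,
      Complex.conj_im, Complex.sub_re, Complex.sub_im]
    ring
  have hpoint (x : Torus d N) : 2 * (starRingEnd ℂ (f x) * generator r f x).re =
      ∑ e, r x e * (‖f (nbr x e)‖ ^ 2 - ‖f x‖ ^ 2 - ‖f (nbr x e) - f x‖ ^ 2) := by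
    simp only [generator_apply, Finset.mul_sum, Complex.re_sum, ← polarization,
      mul_left_comm (starRingEnd ℂ (f x)), Complex.re_ofReal_mul, mul_left_comm (2 : ℝ)]
  rw [re_scal, Finset.mul_sum, dirichlet, normSq, Fintype.sum_prod_type]
  simp only [mul_left_comm (2 : ℝ), hpoint, gradient, LinearMap.coe_mk, AddHom.coe_mk,
    mul_sub (r _ _) (_ - _), Finset.sum_sub_distrib, mul_sub (p _), hbalance, zero_sub,
    Finset.mul_sum, mul_assoc]

/-- The Poincaré inequality with constant `κ`, for the form `dirichlet r p` on mean zero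
functions. -/
def HasSpectralGap (r : Rates d N) (p : Torus d N → ℝ) (κ : ℝ) : Prop :=
  ∀ f, mean p f = 0 → κ * normSq p f ≤ dirichlet r p f

theorem ker_gradient_prod_mean (hp : ∀ x, 0 < p x) :
    LinearMap.ker (gradient.prod (mean p).toLinearMap) = ⊥ := by
  rw [LinearMap.ker_eq_bot']
  intro f hf
  obtain ⟨hgrad, hmean⟩ := Prod.mk_eq_zero.1 hf
  have hconst (x : Torus d N) : (∑ y, (p y : ℂ)) * f x = 0 := by
    rw [Finset.sum_mul, ← hmean, ContinuousLinearMap.coe_coe, mean_apply]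
    exact Finset.sum_congr rfl fun y _ => by rw [eq_of_gradient_eq_zero hgrad x y]
  have hmass : (∑ y, (p y : ℂ)) ≠ 0 := by
    exact_mod_cast (Finset.sum_pos (fun y _ => hp y) Finset.univ_nonempty).ne'
  exact funext fun x => (mul_eq_zero.1 (hconst x)).resolve_left hmass

theorem exists_hasSpectralGap (hr : ∀ x e, 0 < r x e) (hp : ∀ x, 0 < p x) :
    ∃ κ > 0, HasSpectralGap r p κ := by
  obtain ⟨K, -, hK⟩ := LinearMap.exists_antilipschitzWith _ (ker_gradient_prod_mean hp)
  set C := (∑ x, p x) * (K ^ 2 * ∑ a : Torus d N × Direction d, (p a.1 * r a.1 a.2)⁻¹)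
  have hC : 0 ≤ C := by
    have (a : Torus d N × Direction d) : 0 ≤ (p a.1 * r a.1 a.2)⁻¹ :=
      (inv_pos.2 (mul_pos (hp _) (hr _ _))).le
    exact mul_nonneg (Finset.sum_nonneg fun x _ => (hp x).le)
      (mul_nonneg (by positivity) (Finset.sum_nonneg fun a _ => this a))
  refine ⟨(C + 1)⁻¹, by positivity, fun f hf => (inv_mul_le_iff₀ (by positivity)).2 ?_⟩
  have hgrad : ‖f‖ ≤ K * ‖gradient f‖ := by
    simpa [hf] using hK.le_mul_norm_sub f 0
  have hdir : 0 ≤ dirichlet r p f := normSq_nonneg (fun a => (mul_pos (hp _) (hr _ _)).le) _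
  calc normSq p f ≤ (∑ x, p x) * (K * ‖gradient f‖) ^ 2 :=
        (normSq_le_mul_norm_sq (fun x => (hp x).le) f).trans <|
          mul_le_mul_of_nonneg_left (pow_le_pow_left₀ (norm_nonneg f) hgrad 2)
            (Finset.sum_nonneg fun x _ => (hp x).le)
    _ ≤ (∑ x, p x) * (K ^ 2 * ((∑ a : Torus d N × Direction d, (p a.1 * r a.1 a.2)⁻¹) *
          dirichlet r p f)) := by
        rw [mul_pow]
        exact mul_le_mul_of_nonneg_left (mul_le_mul_of_nonneg_left
          (norm_sq_le_mul_normSq (fun a => mul_pos (hp _) (hr _ _)) _) (sq_nonneg _))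
          (Finset.sum_nonneg fun x _ => (hp x).le)
    _ = C * dirichlet r p f := by ring
    _ ≤ (C + 1) * dirichlet r p f := by linarith

end DirichletForm

section DifferentialInequality

variable {E E' : ℝ → ℝ} {κ c : ℝ}

theorem antitoneOn_sub_mul_exp (hE : ContinuousOn E (Ici 0))
    (hE' : ∀ t, 0 < t → HasDerivAt E (E' t) t) (hle : ∀ t, 0 < t → E' t ≤ -κ * (E t - c)) :
    AntitoneOn (fun t => (E t - c) * Real.exp (κ * t)) (Ici 0) := by
  have hderiv (t : ℝ) (ht : 0 < t) : HasDerivAt (fun t => (E t - c) * Real.exp (κ * t))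
      (E' t * Real.exp (κ * t) + (E t - c) * (Real.exp (κ * t) * (κ * 1))) t :=
    ((hE' t ht).sub_const c).mul ((hasDerivAt_id t).const_mul κ).exp
  refine antitoneOn_of_hasDerivWithinAt_nonpos (convex_Ici 0)
    ((hE.sub continuousOn_const).mul (by fun_prop))
    (fun t ht => (hderiv t (by simpa using ht)).hasDerivWithinAt) fun t ht => ?_
  calc E' t * Real.exp (κ * t) + (E t - c) * (Real.exp (κ * t) * (κ * 1))
      = (E' t + κ * (E t - c)) * Real.exp (κ * t) := by ring
    _ ≤ 0 := mul_nonpos_of_nonpos_of_nonneg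
        (by linarith [hle t (by simpa using ht)]) (Real.exp_pos _).le

theorem le_mul_exp_of_deriv_le (hE : ContinuousOn E (Ici 0))
    (hE' : ∀ t, 0 < t → HasDerivAt E (E' t) t) (hle : ∀ t, 0 < t → E' t ≤ -κ * E t)
    {t : ℝ} (ht : 0 ≤ t) : E t ≤ E 0 * Real.exp (-(κ * t)) := by
  have hanti := antitoneOn_sub_mul_exp (c := 0) hE hE' (by simpa using hle)
    self_mem_Ici ht ht
  rw [Real.exp_neg, ← div_eq_mul_inv, le_div_iff₀ (Real.exp_pos _)]
  simpa using hanti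

theorem le_of_deriv_le_of_periodic (hκ : 0 < κ) (hE : ContinuousOn E (Ici 0))
    (hE' : ∀ t, 0 < t → HasDerivAt E (E' t) t) (hle : ∀ t, 0 < t → E' t ≤ -κ * (E t - c))
    {T : ℝ} (hT : 0 < T) (hper : E T = E 0) {t : ℝ} (ht : 0 ≤ t) : E t ≤ c := by
  have hanti := antitoneOn_sub_mul_exp hE hE' hle
  have hperiod : (E 0 - c) * Real.exp (κ * T) ≤ E 0 - c := by
    simpa [hper] using hanti self_mem_Ici hT.le hT.le
  have hstart : E 0 - c ≤ 0 := by
    by_contra! hpos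
    have hexp : 1 < Real.exp (κ * T) := Real.one_lt_exp_iff.2 (mul_pos hκ hT)
    linarith [lt_mul_of_one_lt_right hpos hexp]
  have hend : (E t - c) * Real.exp (κ * t) ≤ E 0 - c := by
    simpa using hanti self_mem_Ici ht ht
  exact sub_nonpos.1 (nonpos_of_mul_nonpos_left (hend.trans hstart) (Real.exp_pos _))

end DifferentialInequality

section Semigroup

variable {E : Type*} [NormedAddCommGroup E] [NormedSpace ℂ E]

theorem sub_resolvent_apply {A : E →L[ℂ] E} {z : ℂ} (hz : z ∈ resolventSet ℂ A) (f : E) :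
    (algebraMap ℂ _ z - A) (resolvent A z f) = f :=
  congrArg (fun B : E →L[ℂ] E => B f) (Ring.mul_inverse_cancel _ hz)

theorem apply_exp_neg_smul (B : E →L[ℂ] E) (f : E) (s : ℝ) :
    B (NormedSpace.exp (-((s : ℂ) • B)) f) = NormedSpace.exp (-((s : ℂ) • B)) (B f) :=
  congrArg (fun A : E →L[ℂ] E => A f)
    (((Commute.refl B).smul_right (s : ℂ)).neg_right).exp_right.eq

variable [CompleteSpace E]

theorem hasDerivAt_exp_neg_smul_apply (B : E →L[ℂ] E) (f : E) (s : ℝ) :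
    HasDerivAt (fun s : ℝ => NormedSpace.exp (-((s : ℂ) • B)) f)
      (-B (NormedSpace.exp (-((s : ℂ) • B)) f)) s := by
  have hexp : HasDerivAt (fun s : ℝ => NormedSpace.exp (-((s : ℂ) • B)))
      (-B * NormedSpace.exp (-((s : ℂ) • B))) s := by
    simpa only [Complex.ofRealCLM_apply, Complex.ofReal_one, one_smul, smul_neg,
      Function.comp_def] using (hasDerivAt_exp_smul_const' (𝕂 := ℂ) (-B) (s : ℂ)).scomp s
        (Complex.ofRealCLM.hasDerivAt (x := s))
  exact ((ContinuousLinearMap.apply ℂ E f).restrictScalars ℝ).hasFDerivAt.comp_hasDerivAt s hexp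

theorem apply_exp_neg_smul_eq_zero {B : E →L[ℂ] E} {φ : E →L[ℂ] ℂ} {z : ℂ}
    (hφ : ∀ f, φ (B f) = z * φ f) {f : E} (hf : φ f = 0) (s : ℝ) :
    φ (NormedSpace.exp (-((s : ℂ) • B)) f) = 0 := by
  have hderiv (s : ℝ) : HasDerivAt
      (fun s : ℝ => Complex.exp (s * z) * φ (NormedSpace.exp (-((s : ℂ) • B)) f)) 0 s := by
    have hφy := (φ.restrictScalars ℝ).hasFDerivAt.comp_hasDerivAt s
      (hasDerivAt_exp_neg_smul_apply B f s)
    have hexp := ((Complex.ofRealCLM.hasDerivAt (x := s)).mul_const z).cexp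
    refine (hexp.mul hφy).congr_deriv ?_
    simp only [ContinuousLinearMap.coe_restrictScalars', Function.comp_apply, map_neg, hφ,
      Complex.ofRealCLM_apply, Complex.ofReal_one]
    ring
  have hconst := is_const_of_deriv_eq_zero (fun s => (hderiv s).differentiableAt)
    (fun s => (hderiv s).deriv) s 0
  simpa [hf] using hconst

theorem integral_exp_neg_smul_apply {B : E →L[ℂ] E} {w : E}
    (hint : IntegrableOn (fun s : ℝ => NormedSpace.exp (-((s : ℂ) • B)) (B w)) (Ioi 0))
    (hlim : Tendsto (fun s : ℝ => NormedSpace.exp (-((s : ℂ) • B)) w) atTop (𝓝 0)) :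
    ∫ s in Ioi (0 : ℝ), NormedSpace.exp (-((s : ℂ) • B)) (B w) = w := by
  have hderiv (s : ℝ) : HasDerivAt (fun s : ℝ => NormedSpace.exp (-((s : ℂ) • B)) w)
      (-NormedSpace.exp (-((s : ℂ) • B)) (B w)) s := by
    simpa only [apply_exp_neg_smul] using hasDerivAt_exp_neg_smul_apply B w s
  have hftc := integral_Ioi_of_hasDerivAt_of_tendsto' (fun s _ => hderiv s) hint.neg hlim
  simpa [integral_neg] using hftc

end Semigroup

section GeneratorSemigroup

variable [NeZero N] {r : Rates d N} {p : Torus d N → ℝ}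

theorem scal_smul_self (p : Torus d N → ℝ) (z : ℂ) (f : Torus d N → ℂ) :
    scal p f (z • f) = z * normSq p f := by
  simp only [scal, normSq, Complex.ofReal_sum, Finset.mul_sum, Pi.smul_apply, smul_eq_mul]
  refine Finset.sum_congr rfl fun x _ => ?_
  rw [mul_left_comm _ z, Complex.conj_mul', mul_left_comm]
  push_cast
  rfl

theorem HasSpectralGap.two_mul_re_scal_generator_le {κ : ℝ} (hgap : HasSpectralGap r p κ)
    (hp₀ : ∀ x, 0 < p x) (hp : IsInvariant r p) {f : Torus d N → ℂ} (hf : mean p f = 0) :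
    2 * (scal p f (generator r f)).re ≤ -κ * normSq p f := by
  rw [two_mul_re_scal_generator hp₀ hp, neg_mul]
  exact neg_le_neg (hgap f hf)

/-! ### Resolvent and semigroup -/

theorem mem_resolventSet_generator (hr : ∀ x e, 0 < r x e) (hp₀ : ∀ x, 0 < p x)
    (hp : IsInvariant r p) {z : ℂ} (hz : 0 ≤ z.re) (hz₀ : z ≠ 0) :
    z ∈ resolventSet ℂ (generator r) := by
  refine ContinuousLinearMap.isUnit_iff_bijective.2 <| (Module.End.isUnit_iff _).1 <|
    (LinearMap.isUnit_iff_ker_eq_bot _).2 <| LinearMap.ker_eq_bot'.2 fun f hf => ?_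
  have heigen : generator r f = z • f := (sub_eq_zero.1 hf).symm
  have hmean : mean p f = 0 := by
    have h := mean_generator hp₀ hp f
    rw [heigen, map_smul, smul_eq_mul] at h
    exact (mul_eq_zero.1 h).resolve_left hz₀
  obtain ⟨κ, hκ, hgap⟩ := exists_hasSpectralGap hr hp₀
  have hle := hgap.two_mul_re_scal_generator_le hp₀ hp hmean
  rw [heigen, scal_smul_self, Complex.re_mul_ofReal] at hle
  have hnonneg : 0 ≤ normSq p f := normSq_nonneg (fun x => (hp₀ x).le) f
  have hzero : normSq p f = 0 := by nlinarith [mul_nonneg hz hnonneg]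
  have hnorm := norm_sq_le_mul_normSq hp₀ f
  rw [hzero, mul_zero] at hnorm
  exact norm_eq_zero.1 (pow_eq_zero_iff two_ne_zero |>.1 (le_antisymm hnorm (sq_nonneg _)))

theorem mean_sub_generator (hp₀ : ∀ x, 0 < p x) (hp : IsInvariant r p) (z : ℂ)
    (f : Torus d N → ℂ) : mean p ((algebraMap ℂ _ z - generator r) f) = z * mean p f := by
  simp [Algebra.algebraMap_eq_smul_one, mean_generator hp₀ hp]

theorem mean_resolvent (hp₀ : ∀ x, 0 < p x) (hp : IsInvariant r p) {z : ℂ} (hz₀ : z ≠ 0)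
    (hz : z ∈ resolventSet ℂ (generator r)) {f : Torus d N → ℂ} (hf : mean p f = 0) :
    mean p (resolvent (generator r) z f) = 0 := by
  have h := mean_sub_generator hp₀ hp z (resolvent (generator r) z f)
  rw [sub_resolvent_apply hz, hf] at h
  exact (mul_eq_zero.1 h.symm).resolve_left hz₀

theorem HasSpectralGap.normSq_exp_le {κ : ℝ} (hgap : HasSpectralGap r p κ)
    (hp₀ : ∀ x, 0 < p x) (hp : IsInvariant r p) {z : ℂ} (hz : 0 ≤ z.re) {f : Torus d N → ℂ}
    (hf : mean p f = 0) {s : ℝ} (hs : 0 ≤ s) :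
    normSq p (NormedSpace.exp (-((s : ℂ) • (algebraMap ℂ _ z - generator r))) f) ≤
      normSq p f * Real.exp (-(κ * s)) := by
  set B : (Torus d N → ℂ) →L[ℂ] (Torus d N → ℂ) := algebraMap ℂ _ z - generator r
  have hderiv (t : ℝ) := hasDerivAt_normSq p (hasDerivAt_exp_neg_smul_apply B f t)
  have hle (t : ℝ) : 2 * (scal p (NormedSpace.exp (-((t : ℂ) • B)) f)
      (-B (NormedSpace.exp (-((t : ℂ) • B)) f))).re ≤
        -κ * normSq p (NormedSpace.exp (-((t : ℂ) • B)) f) := by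
    set y := NormedSpace.exp (-((t : ℂ) • B)) f
    have hmean : mean p y = 0 := apply_exp_neg_smul_eq_zero (mean_sub_generator hp₀ hp z) hf t
    have hB : -B y = generator r y - z • y := by
      simp [B, Algebra.algebraMap_eq_smul_one]
    have hdamp : 0 ≤ (scal p y (z • y)).re := by
      rw [scal_smul_self, Complex.re_mul_ofReal]
      exact mul_nonneg hz (normSq_nonneg (fun x => (hp₀ x).le) y)
    rw [hB, ← scalCLM_apply, map_sub, scalCLM_apply, scalCLM_apply, Complex.sub_re]
    linarith [hgap.two_mul_re_scal_generator_le hp₀ hp hmean]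
  simpa only [Complex.ofReal_zero, zero_smul, neg_zero, NormedSpace.exp_zero,
    one_apply_eq_self] using le_mul_exp_of_deriv_le
    (fun t _ => (hderiv t).continuousAt.continuousWithinAt) (fun t _ => hderiv t)
    (fun t _ => hle t) hs

theorem exists_norm_exp_le (hr : ∀ x e, 0 < r x e) (hp₀ : ∀ x, 0 < p x) (hp : IsInvariant r p)
    {z : ℂ} (hz : 0 ≤ z.re) {f : Torus d N → ℂ} (hf : mean p f = 0) :
    ∃ δ > 0, ∃ C, ∀ s : ℝ, 0 ≤ s →
      ‖NormedSpace.exp (-((s : ℂ) • (algebraMap ℂ _ z - generator r))) f‖ ≤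
        C * Real.exp (-δ * s) := by
  obtain ⟨κ, hκ, hgap⟩ := exists_hasSpectralGap hr hp₀
  have hinv : 0 ≤ ∑ x, (p x)⁻¹ := Finset.sum_nonneg fun x _ => (inv_pos.2 (hp₀ x)).le
  refine ⟨κ / 2, by positivity, √((∑ x, (p x)⁻¹) * normSq p f), fun s hs => ?_⟩
  refine le_of_sq_le_sq ?_ (by positivity)
  rw [mul_pow, Real.sq_sqrt (mul_nonneg hinv (normSq_nonneg (fun x => (hp₀ x).le) f)),
    ← Real.exp_nat_mul, show ((2 : ℕ) : ℝ) * (-(κ / 2) * s) = -(κ * s) by push_cast; ring,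
    mul_assoc]
  exact (norm_sq_le_mul_normSq hp₀ _).trans
    (mul_le_mul_of_nonneg_left (hgap.normSq_exp_le hp₀ hp hz hf hs) hinv)

theorem integral_exp_generator (hr : ∀ x e, 0 < r x e) (hp₀ : ∀ x, 0 < p x)
    (hp : IsInvariant r p) {z : ℂ} (hz : 0 ≤ z.re) (hz₀ : z ≠ 0) {f : Torus d N → ℂ}
    (hf : mean p f = 0) :
    IntegrableOn (fun s : ℝ =>
        NormedSpace.exp (-((s : ℂ) • (algebraMap ℂ _ z - generator r))) f) (Ioi 0) ∧
      ∫ s in Ioi (0 : ℝ), NormedSpace.exp (-((s : ℂ) • (algebraMap ℂ _ z - generator r))) f =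
        resolvent (generator r) z f := by
  have hres := mem_resolventSet_generator hr hp₀ hp hz hz₀
  have hint : IntegrableOn (fun s : ℝ =>
      NormedSpace.exp (-((s : ℂ) • (algebraMap ℂ _ z - generator r))) f) (Ioi 0) := by
    obtain ⟨δ, hδ, C, hC⟩ := exists_norm_exp_le hr hp₀ hp hz hf
    refine Integrable.mono' ((exp_neg_integrableOn_Ioi 0 hδ).const_mul C)
      (Continuous.aestronglyMeasurable <| continuous_iff_continuousAt.2 fun s =>
        (hasDerivAt_exp_neg_smul_apply _ f s).continuousAt) ?_
    filter_upwards [ae_restrict_mem measurableSet_Ioi] with s hs using hC s (le_of_lt hs)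
  have hlim : Tendsto (fun s : ℝ => NormedSpace.exp (-((s : ℂ) • (algebraMap ℂ _ z - generator r)))
      (resolvent (generator r) z f)) atTop (𝓝 0) := by
    obtain ⟨δ, hδ, C, hC⟩ := exists_norm_exp_le hr hp₀ hp hz (mean_resolvent hp₀ hp hz₀ hres hf)
    have hexp : Tendsto (fun s : ℝ => C * Real.exp (-δ * s)) atTop (𝓝 0) := by
      simpa using (Real.tendsto_exp_atBot.comp
        (tendsto_id.const_mul_atTop_of_neg (neg_lt_zero.2 hδ))).const_mul C
    exact squeeze_zero_norm' ((eventually_ge_atTop 0).mono hC) hexp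
  refine ⟨hint, ?_⟩
  have hsolve := integral_exp_neg_smul_apply (w := resolvent (generator r) z f)
    (by rwa [sub_resolvent_apply hres]) hlim
  rwa [sub_resolvent_apply hres] at hsolve

theorem laplace_resolvent (hr : ∀ x e, 0 < r x e) (hp₀ : ∀ x, 0 < p x) (hp : IsInvariant r p)
    {ω : ℝ} (hω : ω ≠ 0) (f : Torus d N → ℂ) {h : Torus d N → ℂ} (hh : mean p h = 0) :
    IntegrableOn (laplaceIntegrand p (generator r) ω f h) (Ioi 0) ∧
      scal p f (resolvent (generator r) (Complex.I * (ω : ℂ)) h) =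
        ∫ s in Ioi (0 : ℝ), laplaceIntegrand p (generator r) ω f h s := by
  obtain ⟨hint, hintegral⟩ := integral_exp_generator hr hp₀ hp (z := Complex.I * ω) (by simp)
    (by simp [hω]) hh
  have hscal : laplaceIntegrand p (generator r) ω f h = fun s : ℝ => scalCLM p f
      (NormedSpace.exp (-((s : ℂ) • (algebraMap ℂ _ (Complex.I * (ω : ℂ)) - generator r))) h) :=
    funext fun s => (scalCLM_apply p f _).symm
  rw [hscal, (scalCLM p f).integral_comp_comm hint, hintegral, scalCLM_apply]
  exact ⟨(scalCLM p f).integrable_comp hint, rfl⟩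

end GeneratorSemigroup

/-! ### Periodic solutions of the forced equation -/

section PeriodicForcing

variable [NeZero N] {r : Rates d N} {p : Torus d N → ℝ}

/-- The constant in the bound `HasSpectralGap.norm_le_of_periodic` of periodic solutions by their
forcing. -/
noncomputable def relaxationConst (p : Torus d N → ℝ) (κ : ℝ) : ℝ := √(∑ x, (p x)⁻¹) * (2 / κ)

theorem relaxationConst_nonneg (p : Torus d N → ℝ) {κ : ℝ} (hκ : 0 < κ) :
    0 ≤ relaxationConst p κ := by
  unfold relaxationConst
  positivity

theorem HasSpectralGap.norm_le_of_periodic {κ : ℝ} (hgap : HasSpectralGap r p κ) (hκ : 0 < κ)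
    (hp₀ : ∀ x, 0 < p x) (hp : IsInvariant r p) {h g : ℝ → Torus d N → ℂ} {T K : ℝ} (hT : 0 < T)
    (hcont : ContinuousOn h (Ici 0))
    (hderiv : ∀ t, 0 < t → HasDerivAt h (generator r (h t) + g t) t)
    (hg : ∀ t, 0 < t → ‖g t‖ ≤ K) (hmean : ∀ t, 0 < t → mean p (h t) = 0) (hper : h T = h 0)
    {t : ℝ} (ht : 0 ≤ t) : ‖h t‖ ≤ relaxationConst p κ * K := by
  have hinv : 0 ≤ ∑ x, (p x)⁻¹ := Finset.sum_nonneg fun x _ => (inv_pos.2 (hp₀ x)).le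
  have hK : 0 ≤ K := (norm_nonneg _).trans (hg 1 one_pos)
  have hdissip (s : ℝ) (hs : 0 < s) : 2 * (scal p (h s) (generator r (h s) + g s)).re ≤
      -(κ / 2) * (normSq p (h s) - (2 / κ * K) ^ 2) := by
    have hforce : normSq p (g s) ≤ K ^ 2 := by
      refine (normSq_le_mul_norm_sq (fun x => (hp₀ x).le) _).trans ?_
      rw [hp.sum_eq_one, one_mul]
      exact pow_le_pow_left₀ (norm_nonneg _) (hg s hs) 2
    have hyoung := two_mul_re_scal_le (fun x => (hp₀ x).le) (h s) (g s) (half_pos hκ)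
    have hgen := hgap.two_mul_re_scal_generator_le hp₀ hp (hmean s hs)
    rw [← scalCLM_apply, map_add, scalCLM_apply, scalCLM_apply, Complex.add_re]
    have hconst : κ / 2 * (2 / κ * K) ^ 2 = (κ / 2)⁻¹ * K ^ 2 := by field
    nlinarith [mul_le_mul_of_nonneg_left hforce (inv_pos.2 (half_pos hκ)).le]
  have hnormSq : normSq p (h t) ≤ (2 / κ * K) ^ 2 :=
    le_of_deriv_le_of_periodic (E := fun s => normSq p (h s)) (half_pos hκ)
      (by
        refine continuousOn_finsetSum _ fun x _ => continuousOn_const.mul ?_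
        exact ((continuousOn_pi.1 hcont x).norm.pow 2))
      (fun s hs => hasDerivAt_normSq p (hderiv s hs)) hdissip hT (by simp only [hper]) ht
  refine le_of_sq_le_sq ?_ (mul_nonneg (relaxationConst_nonneg p hκ) hK)
  rw [relaxationConst, mul_assoc, mul_pow, Real.sq_sqrt hinv]
  exact (norm_sq_le_mul_normSq hp₀ _).trans (mul_le_mul_of_nonneg_left hnormSq hinv)

end PeriodicForcing

/-! ### Expectations along the lifted walk -/

section Clamp

/-- Truncation of `x` to the interval `[-m, m]`, used to extend Dynkin's formula from bounded
functions to functions with bounded jumps. -/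
noncomputable def clamp (m x : ℝ) : ℝ := max (-m) (min x m)

theorem abs_clamp_le {m : ℝ} (hm : 0 ≤ m) (x : ℝ) : |clamp m x| ≤ m :=
  abs_le.2 ⟨le_max_left _ _, max_le (by linarith) (min_le_right _ _)⟩

theorem abs_clamp_le_abs {m : ℝ} (hm : 0 ≤ m) (x : ℝ) : |clamp m x| ≤ |x| :=
  abs_le.2 ⟨le_max_of_le_right (le_min (neg_abs_le x) (by linarith [abs_nonneg x])),
    max_le (by linarith [abs_nonneg x]) ((min_le_left _ _).trans (le_abs_self x))⟩

theorem abs_clamp_sub_clamp_le (m x y : ℝ) : |clamp m x - clamp m y| ≤ |x - y| := by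
  refine (abs_max_sub_max_le_max _ _ _ _).trans (max_le (by simp) ?_)
  exact (abs_min_sub_min_le_max _ _ _ _).trans (by simp)

theorem tendsto_clamp (x : ℝ) : Tendsto (fun n : ℕ => clamp n x) atTop (𝓝 x) := by
  refine tendsto_const_nhds.congr' ?_
  filter_upwards [eventually_ge_atTop ⌈|x|⌉₊] with n hn
  have hx := abs_le.1 (Nat.ceil_le.1 hn)
  rw [clamp, min_eq_left hx.2, max_eq_right hx.1]

theorem continuous_clamp (m : ℝ) : Continuous (clamp m) := by
  unfold clamp
  fun_prop

variable {α : Type*} [MeasurableSpace α] {μ : Measure α} {X : α → ℝ}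

theorem tendsto_integral_clamp (hX : Integrable X μ) :
    Tendsto (fun n : ℕ => ∫ a, clamp n (X a) ∂μ) atTop (𝓝 (∫ a, X a ∂μ)) :=
  tendsto_integral_of_dominated_convergence (fun a => |X a|)
    (fun n => (continuous_clamp n).comp_aestronglyMeasurable hX.aestronglyMeasurable) hX.abs
    (fun n => .of_forall fun a => abs_clamp_le_abs n.cast_nonneg (X a))
    (.of_forall fun a => tendsto_clamp (X a))

theorem integrable_of_integral_abs_clamp_le [IsFiniteMeasure μ] (hX : AEStronglyMeasurable X μ)
    {K : ℝ} (hK : ∀ n : ℕ, ∫ a, |clamp n (X a)| ∂μ ≤ K) : Integrable X μ := by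
  have hmeas (n : ℕ) : AEStronglyMeasurable (fun a => clamp n (X a)) μ :=
    (continuous_clamp n).comp_aestronglyMeasurable hX
  have hle (n : ℕ) : ∫⁻ a, ‖clamp n (X a)‖ₑ ∂μ ≤ ENNReal.ofReal K := by
    have hint : Integrable (fun a => clamp n (X a)) μ :=
      .of_bound (hmeas n) n (.of_forall fun a => abs_clamp_le n.cast_nonneg (X a))
    rw [← ofReal_integral_norm_eq_lintegral_enorm hint]
    exact ENNReal.ofReal_le_ofReal (hK n)
  refine ⟨hX, lt_of_le_of_lt ?_ (ENNReal.ofReal_lt_top (r := K))⟩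
  calc ∫⁻ a, ‖X a‖ₑ ∂μ
      = ∫⁻ a, liminf (fun n : ℕ => ‖clamp n (X a)‖ₑ) atTop ∂μ :=
        lintegral_congr fun a => (tendsto_clamp (X a)).enorm.liminf_eq.symm
    _ ≤ liminf (fun n : ℕ => ∫⁻ a, ‖clamp n (X a)‖ₑ ∂μ) atTop :=
        lintegral_liminf_le' fun n => (hmeas n).enorm
    _ ≤ ENNReal.ofReal K := by
        refine (liminf_le_liminf (.of_forall hle)).trans ?_
        simp only [liminf_const, le_refl]

end Clamp

section RightContinuous

theorem tendsto_ceil_mul_div_nhdsGE (t : ℝ≥0) :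
    Tendsto (fun n : ℕ => (⌈t * n⌉₊ : ℝ≥0) / n) atTop (𝓝[≥] t) := by
  refine tendsto_nhdsWithin_iff.2 ⟨?_, ?_⟩
  · rw [← NNReal.tendsto_coe]
    have hreal := (tendsto_nat_ceil_mul_div_atTop t.coe_nonneg).comp
      (tendsto_natCast_atTop_atTop (R := ℝ))
    refine hreal.congr fun n => ?_
    rw [Function.comp_apply, NNReal.coe_div, NNReal.coe_natCast, NNReal.coe_natCast]
    rfl
  · filter_upwards [eventually_gt_atTop 0] with n hn
    rw [mem_Ici, le_div_iff₀ (Nat.cast_pos.2 hn)]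
    exact Nat.le_ceil _

theorem measurable_uncurry_of_continuousWithinAt_Ici {Ω E : Type*} [MeasurableSpace Ω]
    [TopologicalSpace E] [TopologicalSpace.PseudoMetrizableSpace E] [MeasurableSpace E]
    [BorelSpace E] {Y : ℝ≥0 → Ω → E} (hm : ∀ t, Measurable (Y t))
    (hc : ∀ a t, ContinuousWithinAt (fun s => Y s a) (Ici t) t) :
    Measurable (Function.uncurry Y) := by
  refine measurable_of_tendsto_metrizable
    (f := fun (n : ℕ) (q : ℝ≥0 × Ω) => Y ((⌈q.1 * n⌉₊ : ℝ≥0) / n) q.2) (fun n => ?_)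
    (tendsto_pi_nhds.2 fun q => (hc q.2 q.1).tendsto.comp (tendsto_ceil_mul_div_nhdsGE q.1))
  have hgrid : Measurable fun q : ℕ × Ω => Y ((q.1 : ℝ≥0) / n) q.2 :=
    measurable_from_prod_countable_right fun k => hm (k / n)
  exact hgrid.comp
    ((Nat.measurable_ceil.comp (measurable_fst.mul_const _)).prodMk measurable_snd)

end RightContinuous

theorem continuous_perturbed (r : Rates d N) (ω : ℝ) (v : Fin d → ℝ) (l : ℝ) (x : Torus d N)
    (e : Direction d) : Continuous fun s => perturbed r ω v l s x e := by
  unfold perturbed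
  fun_prop

theorem liftedGenerator_comp_proj (r : Rates d N) (ω : ℝ) (v : Fin d → ℝ) (l t : ℝ)
    (g : Torus d N → ℝ) (y : Fin d → ℤ) :
    liftedGenerator r ω v l t (g ∘ proj N) y =
      ∑ e, perturbed r ω v l t (proj N y) e * (g (nbr (proj N y) e) - g (proj N y)) := by
  simp only [liftedGenerator, Function.comp_apply, proj_add, nbr]

theorem liftedGenerator_coordinate (r : Rates d N) (ω : ℝ) (v : Fin d → ℝ) (l t : ℝ) (j : Fin d)
    (y : Fin d → ℤ) :
    liftedGenerator r ω v l t (fun y => (y j : ℝ)) y =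
      gammaFun (perturbed r ω v l t) j (proj N y) := by
  rw [← sum_mul_vec]
  simp only [liftedGenerator, Pi.add_apply, Int.cast_add, add_sub_cancel_left]

section LiftedWalk

variable {r : Rates d N} {ω : ℝ} {v : Fin d → ℝ} {l : ℝ} {Ω : Type*} [mΩ : MeasurableSpace Ω]
  {P : Measure Ω} {Y : ℝ≥0 → Ω → Fin d → ℤ}

theorem IsLiftedWalk.measurable (h : IsLiftedWalk r ω v l P Y) (t : ℝ≥0) : Measurable (Y t) := by
  obtain ⟨ℱ, hℱ, -⟩ := h.martingale_problem
  exact (hℱ t).mono (ℱ.le t) le_rfl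

theorem IsLiftedWalk.aestronglyMeasurable_comp (h : IsLiftedWalk r ω v l P Y)
    (f : (Fin d → ℤ) → ℝ) (t : ℝ≥0) : AEStronglyMeasurable (fun a => f (Y t a)) P :=
  ((Measurable.of_discrete (f := f)).comp (h.measurable t)).aestronglyMeasurable

theorem IsLiftedWalk.measurable_liftedGenerator (h : IsLiftedWalk r ω v l P Y)
    (f : (Fin d → ℤ) → ℝ) :
    Measurable fun q : ℝ × Ω => liftedGenerator r ω v l q.1 f (Y q.1.toNNReal q.2) := by
  have hY : Measurable fun q : ℝ × Ω => Y q.1.toNNReal q.2 :=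
    (measurable_uncurry_of_continuousWithinAt_Ici h.measurable h.right_continuous).comp
      ((measurable_real_toNNReal.comp measurable_fst).prodMk measurable_snd)
  unfold liftedGenerator perturbed
  refine Finset.measurable_sum _ fun e _ => ?_
  have hrate : Measurable fun q : ℝ × Ω => r (proj N (Y q.1.toNNReal q.2)) e :=
    (Measurable.of_discrete (f := fun y => r (proj N y) e)).comp hY
  have hincr : Measurable fun q : ℝ × Ω =>
      f (Y q.1.toNNReal q.2 + e.vec) - f (Y q.1.toNNReal q.2) :=
    (Measurable.of_discrete (f := fun y => f (y + e.vec) - f y)).comp hY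
  have hexp : Measurable fun q : ℝ × Ω => Real.exp (l * Real.cos (ω * q.1) * e.dot v) := by
    fun_prop
  exact (hexp.mul hrate).mul hincr

theorem IsLiftedWalk.measurable_integral_liftedGenerator [SFinite P]
    (h : IsLiftedWalk r ω v l P Y) (f : (Fin d → ℤ) → ℝ) :
    StronglyMeasurable fun s : ℝ => ∫ a, liftedGenerator r ω v l s f (Y s.toNNReal a) ∂P :=
  (h.measurable_liftedGenerator f).stronglyMeasurable.integral_prod_right'

variable [NeZero N]

/-- A bound on the total jump rates of the perturbed walk, uniform in space and time. -/
noncomputable def rateBound (r : Rates d N) (v : Fin d → ℝ) (l : ℝ) : ℝ :=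
  ∑ x, ∑ e : Direction d, Real.exp |l * e.dot v| * |r x e|

theorem sum_abs_perturbed_le (r : Rates d N) (ω : ℝ) (v : Fin d → ℝ) (l s : ℝ) (x : Torus d N) :
    ∑ e, |perturbed r ω v l s x e| ≤ rateBound r v l := by
  refine le_trans (Finset.sum_le_sum fun e _ => ?_)
    (Finset.single_le_sum (f := fun x => ∑ e : Direction d, Real.exp |l * e.dot v| * |r x e|)
      (fun _ _ => Finset.sum_nonneg fun _ _ => by positivity) (Finset.mem_univ x))
  rw [perturbed, abs_mul, Real.abs_exp]
  gcongr
  calc l * Real.cos (ω * s) * e.dot v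
      ≤ |l * e.dot v * Real.cos (ω * s)| := by rw [mul_right_comm]; exact le_abs_self _
    _ ≤ |l * e.dot v| := by
        rw [abs_mul]
        exact mul_le_of_le_one_right (abs_nonneg _) (Real.abs_cos_le_one _)

theorem abs_liftedGenerator_le (r : Rates d N) (ω : ℝ) (v : Fin d → ℝ) (l s : ℝ)
    {f : (Fin d → ℤ) → ℝ} {c : ℝ} (hc : 0 ≤ c)
    (hf : ∀ y (e : Direction d), |f (y + e.vec) - f y| ≤ c) (y : Fin d → ℤ) :
    |liftedGenerator r ω v l s f y| ≤ rateBound r v l * c :=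
  calc |liftedGenerator r ω v l s f y|
      ≤ ∑ e : Direction d, |perturbed r ω v l s (proj N y) e * (f (y + e.vec) - f y)| :=
        Finset.abs_sum_le_sum_abs _ _
    _ ≤ ∑ e : Direction d, |perturbed r ω v l s (proj N y) e| * c := by
        gcongr with e
        rw [abs_mul]
        gcongr
        exact hf y e
    _ ≤ rateBound r v l * c := by
        rw [← Finset.sum_mul]
        exact mul_le_mul_of_nonneg_right (sum_abs_perturbed_le r ω v l s (proj N y)) hc

variable [IsProbabilityMeasure P]

theorem norm_integral_liftedGenerator_le {f : (Fin d → ℤ) → ℝ} {c : ℝ} (hc : 0 ≤ c)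
    (hf : ∀ y (e : Direction d), |f (y + e.vec) - f y| ≤ c) (s : ℝ) :
    ‖∫ a, liftedGenerator r ω v l s f (Y s.toNNReal a) ∂P‖ ≤ rateBound r v l * c := by
  simpa using norm_integral_le_of_norm_le_const (μ := P) (C := rateBound r v l * c)
    (f := fun a => liftedGenerator r ω v l s f (Y s.toNNReal a))
    (.of_forall fun a => abs_liftedGenerator_le r ω v l s hc hf _)

theorem IsLiftedWalk.dynkin_formula_of_bounded (h : IsLiftedWalk r ω v l P Y)
    {f : (Fin d → ℤ) → ℝ} {C : ℝ} (hf : ∀ y, |f y| ≤ C) {t : ℝ} (ht : 0 ≤ t) :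
    ∫ a, f (Y t.toNNReal a) ∂P = ∫ a, f (Y 0 a) ∂P +
      ∫ s in (0 : ℝ)..t, ∫ a, liftedGenerator r ω v l s f (Y s.toNNReal a) ∂P := by
  obtain ⟨ℱ, -, hmart⟩ := h.martingale_problem
  have hM := hmart f ⟨C, hf⟩
  have hC : 0 ≤ C := (abs_nonneg _).trans (hf 0)
  have hmean := hM.setIntegral_eq (zero_le (a := t.toNNReal)) MeasurableSet.univ
  have hintM := hM.integrable t.toNNReal
  simp only [setIntegral_univ, NNReal.coe_zero, intervalIntegral.integral_same, sub_zero,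
    Real.coe_toNNReal t ht] at hmean hintM
  have hint : Integrable (fun a => f (Y t.toNNReal a)) P :=
    .of_bound (h.aestronglyMeasurable_comp f _) C (.of_forall fun a => hf _)
  have hintA : Integrable
      (fun a => ∫ s in (0 : ℝ)..t, liftedGenerator r ω v l s f (Y s.toNNReal a)) P := by
    simpa only [Pi.sub_apply, sub_sub_cancel] using hint.sub' hintM
  rw [integral_sub hint hintA] at hmean
  rw [hmean, intervalIntegral_integral_swap, sub_add_cancel]
  have hincr (y) (e : Direction d) : |f (y + e.vec) - f y| ≤ C + C :=
    (abs_sub _ _).trans (add_le_add (hf _) (hf _))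
  rw [uIoc_of_le ht]
  exact Integrable.of_bound (h.measurable_liftedGenerator f).aestronglyMeasurable
    (rateBound r v l * (C + C)) (.of_forall fun q =>
      abs_liftedGenerator_le r ω v l q.1 (by positivity) hincr _)

variable {f : (Fin d → ℤ) → ℝ} {c : ℝ}

theorem IsLiftedWalk.integrable (h : IsLiftedWalk r ω v l P Y) (hc : 0 ≤ c)
    (hf : ∀ y (e : Direction d), |f (y + e.vec) - f y| ≤ c)
    (h0 : Integrable (fun a => f (Y 0 a)) P) (t : ℝ≥0) : Integrable (fun a => f (Y t a)) P := by
  refine integrable_of_integral_abs_clamp_le (h.aestronglyMeasurable_comp f t)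
    (K := ∫ a, |f (Y 0 a)| ∂P + rateBound r v l * c * t) fun n => ?_
  have hbdd (y) : |(|clamp n (f y)|)| ≤ n := (abs_abs _).trans_le (abs_clamp_le n.cast_nonneg _)
  have hincr (y) (e : Direction d) :
        |(|clamp n (f (y + e.vec))|) - (|clamp n (f y)|)| ≤ c :=
    (abs_abs_sub_abs_le_abs_sub _ _).trans ((abs_clamp_sub_clamp_le _ _ _).trans (hf y e))
  have hdynkin := h.dynkin_formula_of_bounded hbdd t.coe_nonneg
  rw [Real.toNNReal_coe] at hdynkin
  rw [hdynkin]
  refine add_le_add (integral_mono_of_nonneg (.of_forall fun a => abs_nonneg _) h0.abs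
    (.of_forall fun a => abs_clamp_le_abs n.cast_nonneg _)) ?_
  have htime := intervalIntegral.norm_integral_le_of_norm_le_const (a := 0) (b := t)
    fun s _ => norm_integral_liftedGenerator_le (r := r) (ω := ω) (v := v) (l := l) (P := P)
      (Y := Y) (f := fun y => |clamp n (f y)|) hc hincr s
  rw [sub_zero, NNReal.abs_eq] at htime
  exact (le_abs_self _).trans htime

theorem IsLiftedWalk.tendsto_integral_liftedGenerator_clamp (h : IsLiftedWalk r ω v l P Y)
    (hc : 0 ≤ c) (hf : ∀ y (e : Direction d), |f (y + e.vec) - f y| ≤ c) (s : ℝ) :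
    Tendsto (fun n : ℕ =>
        ∫ a, liftedGenerator r ω v l s (fun y => clamp n (f y)) (Y s.toNNReal a) ∂P)
      atTop (𝓝 (∫ a, liftedGenerator r ω v l s f (Y s.toNNReal a) ∂P)) :=
  tendsto_integral_of_dominated_convergence (fun _ => rateBound r v l * c)
    (fun _ => h.aestronglyMeasurable_comp _ _) (integrable_const _)
    (fun _ => .of_forall fun _ => abs_liftedGenerator_le r ω v l s hc
      (fun y e => (abs_clamp_sub_clamp_le _ _ _).trans (hf y e)) _)
    (.of_forall fun _ => tendsto_finsetSum _ fun _ _ =>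
      ((tendsto_clamp _).sub (tendsto_clamp _)).const_mul _)

theorem IsLiftedWalk.dynkin_formula (h : IsLiftedWalk r ω v l P Y) (hc : 0 ≤ c)
    (hf : ∀ y (e : Direction d), |f (y + e.vec) - f y| ≤ c)
    (h0 : Integrable (fun a => f (Y 0 a)) P) {t : ℝ} (ht : 0 ≤ t) :
    ∫ a, f (Y t.toNNReal a) ∂P = ∫ a, f (Y 0 a) ∂P +
      ∫ s in (0 : ℝ)..t, ∫ a, liftedGenerator r ω v l s f (Y s.toNNReal a) ∂P := by
  have hlim : Tendsto (fun n : ℕ => ∫ s in (0 : ℝ)..t,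
      ∫ a, liftedGenerator r ω v l s (fun y => clamp n (f y)) (Y s.toNNReal a) ∂P) atTop
      (𝓝 (∫ s in (0 : ℝ)..t, ∫ a, liftedGenerator r ω v l s f (Y s.toNNReal a) ∂P)) :=
    intervalIntegral.tendsto_integral_filter_of_dominated_convergence
      (fun _ => rateBound r v l * c)
      (.of_forall fun n => (h.measurable_integral_liftedGenerator _).aestronglyMeasurable)
      (.of_forall fun n => .of_forall fun s _ => norm_integral_liftedGenerator_le hc
        (fun y e => (abs_clamp_sub_clamp_le _ _ _).trans (hf y e)) s)
      intervalIntegrable_const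
      (.of_forall fun s _ => h.tendsto_integral_liftedGenerator_clamp hc hf s)
  refine tendsto_nhds_unique (tendsto_integral_clamp (h.integrable hc hf h0 t.toNNReal))
    (((tendsto_integral_clamp h0).add hlim).congr fun n => ?_)
  exact (h.dynkin_formula_of_bounded (fun y => abs_clamp_le n.cast_nonneg (f y)) ht).symm

theorem IsLiftedWalk.continuous_integral (h : IsLiftedWalk r ω v l P Y) (hc : 0 ≤ c)
    (hf : ∀ y (e : Direction d), |f (y + e.vec) - f y| ≤ c)
    (h0 : Integrable (fun a => f (Y 0 a)) P) :
    Continuous fun t : ℝ => ∫ a, f (Y t.toNNReal a) ∂P := by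
  have hprim : Continuous fun t : ℝ =>
      ∫ s in (0 : ℝ)..t, ∫ a, liftedGenerator r ω v l s f (Y s.toNNReal a) ∂P :=
    intervalIntegral.continuous_primitive (fun a b =>
      (intervalIntegrable_const (c := rateBound r v l * c)).mono_fun'
        (h.measurable_integral_liftedGenerator f).aestronglyMeasurable
        (.of_forall fun s => norm_integral_liftedGenerator_le hc hf s)) 0
  have hmax : Continuous fun t : ℝ => max t 0 := by fun_prop
  refine ((hprim.comp hmax).const_add (∫ a, f (Y 0 a) ∂P)).congr fun t => ?_
  rw [Function.comp_apply, ← h.dynkin_formula hc hf h0 (le_max_right t 0)]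
  simp only [Real.toNNReal, max_assoc, max_self]

/-- The law at time `t` of the walk on the torus. -/
noncomputable def law (N : ℕ) (P : Measure Ω) (Y : ℝ≥0 → Ω → Fin d → ℤ) (t : ℝ)
    (x : Torus d N) : ℝ :=
  P.real {a | proj N (Y t.toNNReal a) = x}

omit [NeZero N] [IsProbabilityMeasure P] in
theorem law_nonneg (t : ℝ) (x : Torus d N) : 0 ≤ law N P Y t x := measureReal_nonneg

omit [NeZero N] in
theorem law_le_one (t : ℝ) (x : Torus d N) : law N P Y t x ≤ 1 :=
  measureReal_le_one

theorem IsLiftedWalk.integral_comp_proj (h : IsLiftedWalk r ω v l P Y) (t : ℝ)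
    (g : Torus d N → ℝ) :
    ∫ a, g (proj N (Y t.toNNReal a)) ∂P = ∑ x, law N P Y t x * g x := by
  let _ : MeasurableSpace (Torus d N) := ⊤
  have : MeasurableSingletonClass (Torus d N) := ⟨fun _ => trivial⟩
  have hX : Measurable fun a => proj N (Y t.toNNReal a) :=
    (Measurable.of_discrete (f := proj N)).comp (h.measurable _)
  have := Measure.isProbabilityMeasure_map (μ := P) hX.aemeasurable
  calc ∫ a, g (proj N (Y t.toNNReal a)) ∂P
      = ∫ x, g x ∂(P.map fun a => proj N (Y t.toNNReal a)) :=
        (integral_map hX.aemeasurable (measurable_from_top (f := g)).aestronglyMeasurable).symm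
    _ = ∑ x, law N P Y t x * g x := by
        rw [integral_fintype .of_finite]
        refine Finset.sum_congr rfl fun x _ => ?_
        rw [map_measureReal_apply hX (measurableSet_singleton x), smul_eq_mul]
        rfl

theorem IsLiftedWalk.sum_law (h : IsLiftedWalk r ω v l P Y) (t : ℝ) :
    ∑ x, law N P Y t x = 1 := by
  simpa using (h.integral_comp_proj t fun _ => 1).symm

theorem abs_comp_proj_sub_le (g : Torus d N → ℝ) (y z : Fin d → ℤ) :
    |g (proj N y) - g (proj N z)| ≤ ‖g‖ + ‖g‖ :=
  (abs_sub _ _).trans (add_le_add (norm_le_pi_norm g _) (norm_le_pi_norm g _))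

theorem IsLiftedWalk.integrable_comp_proj (h : IsLiftedWalk r ω v l P Y) (g : Torus d N → ℝ)
    (t : ℝ≥0) : Integrable (fun a => g (proj N (Y t a))) P :=
  .of_bound (h.aestronglyMeasurable_comp (g ∘ proj N) t) ‖g‖
    (.of_forall fun _ => norm_le_pi_norm g _)

theorem IsLiftedWalk.integral_single_proj [DecidableEq (Torus d N)] (h : IsLiftedWalk r ω v l P Y)
    (t : ℝ) (x : Torus d N) :
    ∫ a, (Pi.single x 1 : Torus d N → ℝ) (proj N (Y t.toNNReal a)) ∂P = law N P Y t x := by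
  rw [h.integral_comp_proj]
  simp only [Pi.single_apply, mul_ite, mul_one, mul_zero, Finset.sum_ite_eq', Finset.mem_univ,
    if_true]

theorem IsLiftedWalk.continuous_law (h : IsLiftedWalk r ω v l P Y) (x : Torus d N) :
    Continuous fun t => law N P Y t x := by
  classical
  exact (h.continuous_integral (f := Pi.single x 1 ∘ proj N) (by positivity)
    (fun y e => abs_comp_proj_sub_le _ _ _) (h.integrable_comp_proj _ 0)).congr
    fun t => h.integral_single_proj t x

theorem IsLiftedWalk.hasDerivWithinAt_integral (h : IsLiftedWalk r ω v l P Y) (hc : 0 ≤ c)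
    (hf : ∀ y (e : Direction d), |f (y + e.vec) - f y| ≤ c)
    (h0 : Integrable (fun a => f (Y 0 a)) P) {G : ℝ → Torus d N → ℝ}
    (hG : ∀ x, Continuous fun s => G s x)
    (hfG : ∀ s y, liftedGenerator r ω v l s f y = G s (proj N y)) {t : ℝ} (ht : 0 ≤ t) :
    HasDerivWithinAt (fun t : ℝ => ∫ a, f (Y t.toNNReal a) ∂P) (∑ x, law N P Y t x * G t x)
      (Ici 0) t := by
  have hcont : Continuous fun s => ∑ x, law N P Y s x * G s x :=
    continuous_finsetSum _ fun x _ => (h.continuous_law x).mul (hG x)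
  have hprim (s : ℝ) (hs : 0 ≤ s) : ∫ a, f (Y s.toNNReal a) ∂P =
      ∫ a, f (Y 0 a) ∂P + ∫ u in (0 : ℝ)..s, ∑ x, law N P Y u x * G u x := by
    rw [h.dynkin_formula hc hf h0 hs]
    simp only [hfG, h.integral_comp_proj]
  exact ((hcont.integral_hasStrictDerivAt 0 t).hasDerivAt.const_add _).hasDerivWithinAt.congr
    hprim (hprim t ht)

theorem IsLiftedWalk.hasDerivWithinAt_law (h : IsLiftedWalk r ω v l P Y) {t : ℝ} (ht : 0 ≤ t)
    (x : Torus d N) :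
    HasDerivWithinAt (fun s => law N P Y s x)
      (∑ e : Direction d, law N P Y t (nbr x e) * perturbed r ω v l t (nbr x e) e.opp
        - law N P Y t x * ∑ e, perturbed r ω v l t x e) (Ici 0) t := by
  classical
  have hderiv := h.hasDerivWithinAt_integral (f := Pi.single x 1 ∘ proj N) (by positivity)
    (fun y e => abs_comp_proj_sub_le _ _ _) (h.integrable_comp_proj _ 0)
    (G := fun s z => ∑ e, perturbed r ω v l s z e *
      ((Pi.single x 1 : Torus d N → ℝ) (nbr z e) - (Pi.single x 1 : Torus d N → ℝ) z))
    (fun z => continuous_finsetSum _ fun e _ =>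
      (continuous_perturbed r ω v l z e).mul continuous_const)
    (fun s y => liftedGenerator_comp_proj r ω v l s _ y) ht
  rw [sum_by_parts] at hderiv
  refine (hderiv.congr (fun s _ => (h.integral_single_proj s x).symm)
    (h.integral_single_proj t x).symm).congr_deriv ?_
  simp only [Pi.single_apply, mul_ite, mul_one, mul_zero, Finset.sum_ite_eq', Finset.mem_univ,
    if_true]

/-! ### The mean velocity -/

omit [IsProbabilityMeasure P] [NeZero N] in
theorem abs_coordinate_add_vec_sub_le (j : Fin d) (y : Fin d → ℤ) (e : Direction d) :
    |((y + e.vec) j : ℝ) - (y j : ℝ)| ≤ 1 := by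
  simpa using e.abs_vec_le_one j

theorem IsOscillatorySteadyState.integrable (h : IsOscillatorySteadyState r ω v l P Y) (t : ℝ≥0)
    (j : Fin d) : Integrable (fun a => (Y t a j : ℝ)) P :=
  h.walk.integrable (f := fun y => (y j : ℝ)) zero_le_one (abs_coordinate_add_vec_sub_le j)
    (h.integrable_start j) t

theorem IsOscillatorySteadyState.hasDerivWithinAt_meanPosition
    (h : IsOscillatorySteadyState r ω v l P Y) {t : ℝ} (ht : 0 ≤ t) :
    HasDerivWithinAt (meanPosition P Y)
      (fun j => ∑ x, law N P Y t x * gammaFun (perturbed r ω v l t) j x) (Ici 0) t :=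
  hasDerivWithinAt_pi.2 fun j =>
    h.walk.hasDerivWithinAt_integral (f := fun y => (y j : ℝ)) zero_le_one
      (abs_coordinate_add_vec_sub_le j) (h.integrable_start j)
      (fun x => (continuous_perturbed r ω v l x (j, 1)).sub
        (continuous_perturbed r ω v l x (j, -1)))
      (fun s y => liftedGenerator_coordinate r ω v l s j y) ht

theorem IsOscillatorySteadyState.meanVelocity_apply
    (h : IsOscillatorySteadyState r ω v l P Y) {t : ℝ} (ht : 0 ≤ t) (j : Fin d) :
    meanVelocity P Y t j = ∑ x, law N P Y t x * gammaFun (perturbed r ω v l t) j x :=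
  congrFun ((h.hasDerivWithinAt_meanPosition ht).derivWithin (uniqueDiffOn_Ici 0 t ht)) j

theorem IsOscillatorySteadyState.meanVelocity_eq_sum_integral
    (h : IsOscillatorySteadyState r ω v l P Y) {t : ℝ} (ht : 0 ≤ t) (j : Fin d) :
    meanVelocity P Y t j = ∑ e : Direction d,
      (∫ a, perturbed r ω v l t (proj N (Y t.toNNReal a)) e ∂P) * (e.vec j : ℝ) := by
  have hrate (e : Direction d) := h.walk.integral_comp_proj t fun x => perturbed r ω v l t x e
  simp only [h.meanVelocity_apply ht, ← sum_mul_vec, Finset.mul_sum, hrate, Finset.sum_mul]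
  rw [Finset.sum_comm]
  simp only [mul_assoc]

end LiftedWalk

/-! ### Linear response of the density -/

section Forcing

variable {r : Rates d N} {p : Torus d N → ℝ}

/-- The change of the forward equation for densities when the rates `r(x, x + e)` are
multiplied by `1 + α e`. -/
noncomputable def forcing (r : Rates d N) (p : Torus d N → ℝ) (α : Direction d → ℝ)
    (f : Torus d N → ℂ) : Torus d N → ℂ :=
  fun x => ∑ e, ((reversed r p x e * α e.opp : ℝ) * f (nbr x e) - (r x e * α e : ℝ) * f x)

/-- The function `Ψ · v`. -/
noncomputable def psiDot (r : Rates d N) (p : Torus d N → ℝ) (v : Fin d → ℝ) : Torus d N → ℝ :=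
  fun x => ∑ k, v k * psiFun r p k x

theorem forcing_dot_one (r : Rates d N) (p : Torus d N → ℝ) (v : Fin d → ℝ) :
    forcing r p (fun e => e.dot v) 1 = toC (psiDot r p v) := by
  funext x
  have hreal : ∑ e : Direction d, (reversed r p x e * e.opp.dot v - r x e * e.dot v) =
      ∑ k, v k * psiFun r p k x := by
    simp only [psiFun, mul_neg, Finset.mul_sum, ← Finset.sum_neg_distrib]
    rw [Finset.sum_comm]
    refine Finset.sum_congr rfl fun e _ => ?_
    rw [Direction.dot_opp, mul_neg, ← neg_add', ← add_mul, Direction.dot, Finset.mul_sum,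
      ← Finset.sum_neg_distrib]
    exact Finset.sum_congr rfl fun k _ => by ring
  simp only [forcing, psiDot, toC, Pi.one_apply, mul_one]
  exact_mod_cast hreal

theorem forcing_sub_smul_forcing_one (r : Rates d N) (p : Torus d N → ℝ) (α β : Direction d → ℝ)
    (c : ℝ) (f : Torus d N → ℂ) :
    forcing r p α f - c • forcing r p β 1 =
      forcing r p (α - c • β) 1 + forcing r p α (f - 1) := by
  funext x
  simp only [forcing, Pi.sub_apply, Pi.smul_apply, Pi.add_apply, Pi.one_apply, smul_eq_mul,
    Finset.smul_sum, ← Finset.sum_sub_distrib, ← Finset.sum_add_distrib, Complex.real_smul]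
  refine Finset.sum_congr rfl fun e _ => ?_
  push_cast
  ring

/-- The sum of all jump rates of the walk and of its time reversal. -/
noncomputable def totalRate [NeZero N] (r : Rates d N) (p : Torus d N → ℝ) : ℝ :=
  ∑ x, ∑ e, (reversed r p x e + r x e)

theorem norm_forcing_le [NeZero N] (hr : ∀ x e, 0 < r x e) (hp₀ : ∀ x, 0 < p x)
    {α : Direction d → ℝ} {a b : ℝ} (ha : 0 ≤ a) (hα : ∀ e, |α e| ≤ a) {f : Torus d N → ℂ}
    (hf : ‖f‖ ≤ b) : ‖forcing r p α f‖ ≤ totalRate r p * (a * b) := by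
  have hb : 0 ≤ b := (norm_nonneg f).trans hf
  have hrev (x : Torus d N) (e : Direction d) : 0 ≤ reversed r p x e := (reversed_pos hr hp₀ x e).le
  have hrate (x : Torus d N) : 0 ≤ ∑ e, (reversed r p x e + r x e) :=
    Finset.sum_nonneg fun e _ => add_nonneg (hrev x e) (hr x e).le
  have hterm {q : ℝ} (hq : 0 ≤ q) (e : Direction d) (y : Torus d N) :
      ‖((q * α e : ℝ) : ℂ) * f y‖ ≤ q * (a * b) := by
    rw [norm_mul, Complex.norm_real, norm_mul, Real.norm_of_nonneg hq, mul_assoc]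
    exact mul_le_mul_of_nonneg_left
      (mul_le_mul (hα e) ((norm_le_pi_norm f y).trans hf) (norm_nonneg _) ha) hq
  refine (pi_norm_le_iff_of_nonneg (mul_nonneg (Finset.sum_nonneg fun x _ => hrate x)
    (mul_nonneg ha hb))).2 fun x => ?_
  calc ‖forcing r p α f x‖
      ≤ ∑ e, (reversed r p x e + r x e) * (a * b) := by
        refine (norm_sum_le _ _).trans (Finset.sum_le_sum fun e _ => ?_)
        rw [add_mul]
        exact (norm_sub_le _ _).trans (add_le_add (hterm (hrev x e) _ _) (hterm (hr x e).le _ _))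
    _ = (∑ e, (reversed r p x e + r x e)) * (a * b) := (Finset.sum_mul _ _ _).symm
    _ ≤ totalRate r p * (a * b) :=
        mul_le_mul_of_nonneg_right
          (Finset.single_le_sum (fun y _ => hrate y) (Finset.mem_univ x)) (mul_nonneg ha hb)

end Forcing

section Response

variable {r : Rates d N} {p : Torus d N → ℝ} {ω : ℝ} {v : Fin d → ℝ}

theorem toC_psiDot (r : Rates d N) (p : Torus d N → ℝ) (v : Fin d → ℝ) :
    toC (psiDot r p v) = ∑ k, (v k : ℂ) • toC (psiFun r p k) := by
  funext x
  simp [toC, psiDot]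

/-- The real part of a complex function, again seen as a complex function. -/
noncomputable def rePart : (Torus d N → ℂ) →L[ℝ] (Torus d N → ℂ) :=
  ContinuousLinearMap.pi fun x =>
    Complex.ofRealCLM ∘L Complex.reCLM ∘L ContinuousLinearMap.proj x

theorem rePart_apply (f : Torus d N → ℂ) (x : Torus d N) : rePart f x = ((f x).re : ℂ) := rfl

theorem rePart_smul_toC (c : ℂ) (f : Torus d N → ℝ) : rePart (c • toC f) = c.re • toC f := by
  funext x
  simp [rePart_apply, toC]

variable [NeZero N]

theorem mean_psiDot (hp₀ : ∀ x, 0 < p x) (v : Fin d → ℝ) :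
    mean p (toC (psiDot r p v)) = 0 := by
  simp only [toC_psiDot, map_sum, map_smul, mean_psiFun hp₀, smul_zero, Finset.sum_const_zero]

theorem generator_rePart (r : Rates d N) (f : Torus d N → ℂ) :
    generator r (rePart f) = rePart (generator r f) := by
  funext x
  simp only [rePart_apply, generator_apply, Complex.re_sum, Complex.re_ofReal_mul, Complex.sub_re]
  push_cast
  rfl

theorem mean_rePart (p : Torus d N → ℝ) (f : Torus d N → ℂ) :
    mean p (rePart f) = ((mean p f).re : ℂ) := by
  simp only [mean_apply, rePart_apply, Complex.re_sum, Complex.re_ofReal_mul]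
  push_cast
  rfl

/-- The amplitude `(iω - L*)⁻¹ (Ψ · v)` of the linear response of the density. -/
noncomputable def amplitude (r : Rates d N) (p : Torus d N → ℝ) (ω : ℝ) (v : Fin d → ℝ) :
    Torus d N → ℂ :=
  resolvent (adjGenerator r p) (Complex.I * (ω : ℂ)) (toC (psiDot r p v))

/-- The linear response `Re (e^{iωt} (iω - L*)⁻¹ (Ψ · v))` of the density at time `t`. -/
noncomputable def response (r : Rates d N) (p : Torus d N → ℝ) (ω : ℝ) (v : Fin d → ℝ) (t : ℝ) :
    Torus d N → ℂ :=
  rePart (Complex.exp (Complex.I * ω * t) • amplitude r p ω v)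

theorem mem_resolventSet_adjGenerator (hr : ∀ x e, 0 < r x e) (hp₀ : ∀ x, 0 < p x)
    (hp : IsInvariant r p) (hω : ω ≠ 0) :
    Complex.I * (ω : ℂ) ∈ resolventSet ℂ (adjGenerator r p) :=
  mem_resolventSet_generator (reversed_pos hr hp₀) hp₀ (hp.reversed hp₀) (by simp) (by simp [hω])

theorem mean_response (hr : ∀ x e, 0 < r x e) (hp₀ : ∀ x, 0 < p x) (hp : IsInvariant r p)
    (hω : ω ≠ 0) (t : ℝ) : mean p (response r p ω v t) = 0 := by
  have hamplitude : mean p (amplitude r p ω v) = 0 :=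
    mean_resolvent hp₀ (hp.reversed hp₀) (by simp [hω])
      (mem_resolventSet_adjGenerator hr hp₀ hp hω) (mean_psiDot hp₀ v)
  rw [response, mean_rePart, map_smul, hamplitude, smul_zero, Complex.zero_re, Complex.ofReal_zero]

theorem re_exp_I_mul (ω t : ℝ) : (Complex.exp (Complex.I * ω * t)).re = Real.cos (ω * t) := by
  rw [mul_assoc, ← Complex.ofReal_mul, mul_comm, Complex.exp_ofReal_mul_I_re]

theorem hasDerivAt_response (hr : ∀ x e, 0 < r x e) (hp₀ : ∀ x, 0 < p x) (hp : IsInvariant r p)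
    (hω : ω ≠ 0) (t : ℝ) :
    HasDerivAt (response r p ω v)
      (adjGenerator r p (response r p ω v t) + Real.cos (ω * t) • toC (psiDot r p v)) t := by
  set a := amplitude r p ω v
  set c := Complex.exp (Complex.I * ω * t)
  have hexp : HasDerivAt (fun s : ℝ => Complex.exp (Complex.I * ω * s) • a)
      ((c * (Complex.I * ω * 1)) • a) t :=
    ((Complex.ofRealCLM.hasDerivAt (x := t)).const_mul (Complex.I * (ω : ℂ))).cexp.smul_const a
  have hresolvent : (Complex.I * (ω : ℂ)) • a = adjGenerator r p a + toC (psiDot r p v) := by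
    have h := sub_resolvent_apply (A := adjGenerator r p)
      (mem_resolventSet_adjGenerator hr hp₀ hp hω) (toC (psiDot r p v))
    rw [← h, sub_apply, Algebra.algebraMap_eq_smul_one]
    exact (add_sub_cancel _ _).symm
  refine (rePart.hasFDerivAt.comp_hasDerivAt t hexp).congr_deriv ?_
  rw [mul_one, mul_smul, hresolvent, smul_add, map_add, rePart_smul_toC, re_exp_I_mul, ← map_smul]
  exact congrArg (· + _) (generator_rePart _ _).symm

theorem exp_I_mul_period (hω : ω ≠ 0) :
    Complex.exp (Complex.I * ω * (2 * Real.pi / |ω| : ℝ)) = 1 := by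
  have hω' : (ω : ℂ) ≠ 0 := Complex.ofReal_ne_zero.2 hω
  rw [Complex.exp_eq_one_iff]
  rcases abs_choice ω with h | h
  · exact ⟨1, by rw [h]; push_cast; field⟩
  · exact ⟨-1, by rw [h]; push_cast; field⟩

theorem response_period (r : Rates d N) (p : Torus d N → ℝ) (v : Fin d → ℝ) (hω : ω ≠ 0) :
    response r p ω v (2 * Real.pi / |ω|) = response r p ω v 0 := by
  rw [response, response, exp_I_mul_period hω, Complex.ofReal_zero, mul_zero, Complex.exp_zero]

end Response

section Tilt

variable {ω l : ℝ} {v : Fin d → ℝ}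

/-- The relative change `e^{l cos(ωt) e · v} - 1` of the rates in the direction `e`. -/
noncomputable def tilt (ω : ℝ) (v : Fin d → ℝ) (l t : ℝ) (e : Direction d) : ℝ :=
  Real.exp (l * Real.cos (ω * t) * e.dot v) - 1

theorem perturbed_eq_one_add_tilt_mul (r : Rates d N) (ω : ℝ) (v : Fin d → ℝ) (l t : ℝ)
    (x : Torus d N) (e : Direction d) :
    perturbed r ω v l t x e = (1 + tilt ω v l t e) * r x e := by
  rw [tilt, add_sub_cancel, perturbed]

theorem abs_mul_cos_mul_dot_le (ω : ℝ) (v : Fin d → ℝ) (l t : ℝ) (e : Direction d) :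
    |l * Real.cos (ω * t) * e.dot v| ≤ |l| * ‖v‖ := by
  rw [abs_mul, abs_mul]
  exact mul_le_mul (mul_le_of_le_one_right (abs_nonneg l) (Real.abs_cos_le_one _))
    (e.abs_dot_le v) (abs_nonneg _) (abs_nonneg l)

theorem abs_tilt_le (hl : |l| * ‖v‖ ≤ 1) (t : ℝ) (e : Direction d) :
    |tilt ω v l t e| ≤ 2 * (|l| * ‖v‖) :=
  (Real.abs_exp_sub_one_le ((abs_mul_cos_mul_dot_le ω v l t e).trans hl)).trans
    (mul_le_mul_of_nonneg_left (abs_mul_cos_mul_dot_le ω v l t e) zero_le_two)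

theorem abs_tilt_sub_le (hl : |l| * ‖v‖ ≤ 1) (t : ℝ) (e : Direction d) :
    |tilt ω v l t e - l * Real.cos (ω * t) * e.dot v| ≤ (|l| * ‖v‖) ^ 2 :=
  (Real.abs_exp_sub_one_sub_id_le ((abs_mul_cos_mul_dot_le ω v l t e).trans hl)).trans <|
    sq_le_sq.2 <| (abs_mul_cos_mul_dot_le ω v l t e).trans (le_abs_self _)

end Tilt

section Density

variable {r : Rates d N} {p : Torus d N → ℝ} {ω : ℝ} {v : Fin d → ℝ} {l : ℝ}

theorem forward_equation_density [NeZero N] (hp₀ : ∀ x, 0 < p x) (hp : IsInvariant r p)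
    (α : Direction d → ℝ) (b : Torus d N → ℝ) (x : Torus d N) :
    ∑ e : Direction d, p (nbr x e) * b (nbr x e) * ((1 + α e.opp) * r (nbr x e) e.opp)
        - p x * b x * ∑ e, (1 + α e) * r x e =
      p x * (∑ e, reversed r p x e * (b (nbr x e) - b x) +
        ∑ e, (reversed r p x e * α e.opp * b (nbr x e) - r x e * α e * b x)) := by
  have hflux (e : Direction d) :
      p (nbr x e) * b (nbr x e) * ((1 + α e.opp) * r (nbr x e) e.opp) =
        p x * (reversed r p x e * b (nbr x e) + reversed r p x e * α e.opp * b (nbr x e)) := by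
    linear_combination (-b (nbr x e) * (1 + α e.opp)) * mul_reversed (r := r) hp₀ x e
  have hrate : ∑ e, (1 + α e) * r x e = ∑ e, reversed r p x e + ∑ e, r x e * α e := by
    rw [hp.sum_reversed hp₀, ← Finset.sum_add_distrib]
    exact Finset.sum_congr rfl fun e _ => by ring
  simp only [hflux, hrate, ← Finset.mul_sum, mul_sub, Finset.sum_add_distrib,
    Finset.sum_sub_distrib, ← Finset.sum_mul]
  ring

variable {Ω : Type*} [MeasurableSpace Ω] {P : Measure Ω} {Y : ℝ≥0 → Ω → Fin d → ℤ}

/-- The density with respect to `p` of the law of the walk on the torus at time `t`. -/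
noncomputable def density (p : Torus d N → ℝ) (P : Measure Ω) (Y : ℝ≥0 → Ω → Fin d → ℤ) (t : ℝ) :
    Torus d N → ℂ :=
  toC fun x => law N P Y t x / p x

theorem law_eq_mul_re_density (hp₀ : ∀ x, 0 < p x) (t : ℝ) (x : Torus d N) :
    law N P Y t x = p x * (density p P Y t x).re :=
  (mul_div_cancel₀ _ (hp₀ x).ne').symm

theorem IsOscillatorySteadyState.density_period (h : IsOscillatorySteadyState r ω v l P Y) :
    density p P Y (2 * Real.pi / |ω|) = density p P Y 0 := by
  funext x
  simp only [density, toC, law, Measure.real, Real.toNNReal_zero, h.periodic x]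

variable [NeZero N] [IsProbabilityMeasure P]

theorem norm_density_le (hp₀ : ∀ x, 0 < p x) (t : ℝ) : ‖density p P Y t‖ ≤ ‖p⁻¹‖ := by
  refine (pi_norm_le_iff_of_nonneg (norm_nonneg _)).2 fun x => ?_
  calc ‖density p P Y t x‖ = law N P Y t x / p x := by
        rw [density, toC, Complex.norm_real,
          Real.norm_of_nonneg (div_nonneg (law_nonneg t x) (hp₀ x).le)]
    _ ≤ 1 / p x := div_le_div_of_nonneg_right (law_le_one t x) (hp₀ x).le
    _ ≤ ‖p⁻¹ x‖ := by rw [one_div]; exact le_abs_self _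
    _ ≤ ‖p⁻¹‖ := norm_le_pi_norm _ x

theorem IsLiftedWalk.mean_density_sub_one (h : IsLiftedWalk r ω v l P Y) (hp₀ : ∀ x, 0 < p x)
    (hp : ∑ x, p x = 1) (t : ℝ) : mean p (density p P Y t - 1) = 0 := by
  have hreal : ∑ x, p x * (law N P Y t x / p x - 1) = 0 := by
    simp only [mul_sub, mul_div_cancel₀ _ (hp₀ _).ne', mul_one, Finset.sum_sub_distrib,
      h.sum_law, hp, sub_self]
  simp only [mean_apply, density, toC, Pi.sub_apply, Pi.one_apply]
  exact_mod_cast hreal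

theorem IsLiftedWalk.continuous_density (h : IsLiftedWalk r ω v l P Y) :
    Continuous (density p P Y) :=
  continuous_pi fun x => Complex.continuous_ofReal.comp ((h.continuous_law x).div_const _)

theorem IsLiftedWalk.hasDerivAt_density_sub_one (h : IsLiftedWalk r ω v l P Y)
    (hp₀ : ∀ x, 0 < p x) (hp : IsInvariant r p) {t : ℝ} (ht : 0 < t) :
    HasDerivAt (fun s => density p P Y s - 1)
      (adjGenerator r p (density p P Y t - 1) + forcing r p (tilt ω v l t) (density p P Y t))
      t := by
  refine HasDerivAt.sub_const 1 (hasDerivAt_pi.2 fun x => ?_)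
  have hlaw := (h.hasDerivWithinAt_law ht.le x).hasDerivAt (Ici_mem_nhds ht)
  refine (hlaw.div_const (p x)).ofReal_comp.congr_deriv ?_
  set b : Torus d N → ℝ := fun y => law N P Y t y / p y
  have hlaw_eq (y : Torus d N) : law N P Y t y = p y * b y := (mul_div_cancel₀ _ (hp₀ y).ne').symm
  have hdensity : density p P Y t = toC b := rfl
  simp only [perturbed_eq_one_add_tilt_mul, hlaw_eq]
  rw [forward_equation_density hp₀ hp, mul_div_cancel_left₀ _ (hp₀ x).ne', hdensity, map_sub,
    adjGenerator, generator_one, sub_zero, Pi.add_apply, generator_apply, forcing]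
  simp only [toC]
  push_cast
  rfl

end Density

section Expansion

variable [NeZero N] {r : Rates d N} {p : Torus d N → ℝ} {ω : ℝ} {v : Fin d → ℝ} {l κ : ℝ}
variable {Ω : Type*} [MeasurableSpace Ω] {P : Measure Ω} [IsProbabilityMeasure P]
variable {Y : ℝ≥0 → Ω → Fin d → ℤ}

theorem norm_density_sub_one_le (hgap : HasSpectralGap (reversed r p) p κ) (hκ : 0 < κ)
    (hr : ∀ x e, 0 < r x e) (hp₀ : ∀ x, 0 < p x) (hp : IsInvariant r p) (hω : ω ≠ 0)
    (hY : IsOscillatorySteadyState r ω v l P Y) (hl : |l| * ‖v‖ ≤ 1) {t : ℝ} (ht : 0 ≤ t) :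
    ‖density p P Y t - 1‖ ≤
      relaxationConst p κ * (totalRate r p * (2 * (|l| * ‖v‖) * ‖p⁻¹‖)) :=
  hgap.norm_le_of_periodic (h := fun s => density p P Y s - 1) (T := 2 * Real.pi / |ω|)
    hκ hp₀ (hp.reversed hp₀) (by positivity)
    (hY.walk.continuous_density.sub continuous_const).continuousOn
    (fun _ hs => hY.walk.hasDerivAt_density_sub_one hp₀ hp hs)
    (fun _ _ => norm_forcing_le hr hp₀ (by positivity) (abs_tilt_le hl _) (norm_density_le hp₀ _))
    (fun s _ => hY.walk.mean_density_sub_one hp₀ hp.sum_eq_one s)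
    (by simp only [hY.density_period]) ht

/-- The constant of the second order term in `norm_density_sub_response_le`. -/
noncomputable def remainderConst (r : Rates d N) (p : Torus d N → ℝ) (κ : ℝ) : ℝ :=
  relaxationConst p κ *
    (totalRate r p + totalRate r p * (2 * (relaxationConst p κ * (totalRate r p * (2 * ‖p⁻¹‖)))))

theorem norm_density_sub_response_le (hgap : HasSpectralGap (reversed r p) p κ) (hκ : 0 < κ)
    (hr : ∀ x e, 0 < r x e) (hp₀ : ∀ x, 0 < p x) (hp : IsInvariant r p) (hω : ω ≠ 0)
    (hY : IsOscillatorySteadyState r ω v l P Y) (hl : |l| * ‖v‖ ≤ 1) {t : ℝ} (ht : 0 ≤ t) :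
    ‖density p P Y t - 1 - l • response r p ω v t‖ ≤ remainderConst r p κ * (|l| * ‖v‖) ^ 2 := by
  have hderiv (s : ℝ) (hs : 0 < s) :
      HasDerivAt (fun s => density p P Y s - 1 - l • response r p ω v s)
        (adjGenerator r p (density p P Y s - 1 - l • response r p ω v s) +
          (forcing r p (tilt ω v l s) (density p P Y s) -
            (l * Real.cos (ω * s)) • forcing r p (fun e => e.dot v) 1)) s := by
    refine ((hY.walk.hasDerivAt_density_sub_one hp₀ hp hs).sub
      ((hasDerivAt_response hr hp₀ hp hω s).const_smul l)).congr_deriv ?_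
    rw [map_sub _ (_ - _), ContinuousLinearMap.map_smul_of_tower, forcing_dot_one, smul_add,
      smul_smul]
    abel
  have hforcing (s : ℝ) (hs : 0 < s) : ‖forcing r p (tilt ω v l s) (density p P Y s) -
      (l * Real.cos (ω * s)) • forcing r p (fun e => e.dot v) 1‖ ≤
        totalRate r p * ((|l| * ‖v‖) ^ 2 * 1) + totalRate r p * (2 * (|l| * ‖v‖) *
          (relaxationConst p κ * (totalRate r p * (2 * (|l| * ‖v‖) * ‖p⁻¹‖)))) := by
    rw [forcing_sub_smul_forcing_one]
    exact (norm_add_le _ _).trans (add_le_add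
      (norm_forcing_le hr hp₀ (sq_nonneg _) (abs_tilt_sub_le hl s) norm_one.le)
      (norm_forcing_le hr hp₀ (by positivity) (abs_tilt_le hl s)
        (norm_density_sub_one_le hgap hκ hr hp₀ hp hω hY hl hs.le)))
  refine (hgap.norm_le_of_periodic hκ hp₀ (hp.reversed hp₀) (T := 2 * Real.pi / |ω|)
    (by positivity) ?_ hderiv hforcing (fun s _ => ?_) ?_ ht).trans_eq ?_
  · refine ((hY.walk.continuous_density.sub continuous_const).sub
      (Continuous.const_smul ?_ l)).continuousOn
    exact continuous_iff_continuousAt.2 fun s =>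
      (hasDerivAt_response hr hp₀ hp hω s).continuousAt
  · rw [map_sub, hY.walk.mean_density_sub_one hp₀ hp.sum_eq_one,
      ContinuousLinearMap.map_smul_of_tower, mean_response hr hp₀ hp hω, smul_zero, sub_zero]
  · rw [hY.density_period, response_period r p v hω]
  · rw [remainderConst]
    ring

end Expansion

theorem hasDerivAt_of_eventually_norm_sub_le_sq {E : Type*} [NormedAddCommGroup E]
    [NormedSpace ℝ E] {f : ℝ → E} {f' : E} {x C : ℝ}
    (h : ∀ᶠ y in 𝓝 x, ‖f y - f x - (y - x) • f'‖ ≤ C * (y - x) ^ 2) : HasDerivAt f f' x := by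
  rw [hasDerivAt_iff_isLittleO]
  have hbigO : (fun y => f y - f x - (y - x) • f') =O[𝓝 x] fun y => ‖y - x‖ ^ 2 :=
    .of_bound C <| h.mono fun y hy => by simpa using hy
  exact (hbigO.trans_isLittleO (Asymptotics.isLittleO_pow_sub_sub x one_lt_two))

/-! ### Derivative of the mean velocity -/

section Derivative

variable {r : Rates d N} {p : Torus d N → ℝ} {ω : ℝ} {v : Fin d → ℝ}

theorem hasDerivAt_gammaFun_perturbed (r : Rates d N) (ω : ℝ) (v : Fin d → ℝ) (t : ℝ) (j : Fin d)
    (x : Torus d N) :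
    HasDerivAt (fun l => gammaFun (perturbed r ω v l t) j x)
      (Real.cos (ω * t) * v j * cFun r j x) 0 := by
  have hrate (e : Direction d) :
      HasDerivAt (fun l => perturbed r ω v l t x e) (Real.cos (ω * t) * e.dot v * r x e) 0 := by
    have hexponent : HasDerivAt (fun l : ℝ => l * Real.cos (ω * t) * e.dot v)
        (1 * Real.cos (ω * t) * e.dot v) 0 :=
      ((hasDerivAt_id (0 : ℝ)).mul_const _).mul_const _
    refine (hexponent.exp.mul_const (r x e)).congr_deriv ?_
    simp
  refine ((hrate (j, 1)).sub (hrate (j, -1))).congr_deriv ?_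
  rw [cFun, Direction.dot_eq_sign_mul, Direction.dot_eq_sign_mul]
  push_cast
  ring

variable [NeZero N]

theorem mobility_mulVec (r : Rates d N) (p : Torus d N → ℝ) (ω : ℝ) (v : Fin d → ℝ) (j : Fin d) :
    (mobility r p ω *ᵥ fun k => (v k : ℂ)) j =
      ((∑ x, p x * cFun r j x : ℝ) : ℂ) * v j +
        scal p (toC (gammaFun r j)) (amplitude r p ω v) := by
  have hamplitude : scal p (toC (gammaFun r j)) (amplitude r p ω v) =
      ∑ k, v k * scal p (toC (gammaFun r j))
        (resolvent (adjGenerator r p) (Complex.I * (ω : ℂ)) (toC (psiFun r p k))) := by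
    simp only [← scalCLM_apply, amplitude, toC_psiDot, map_sum, map_smul, smul_eq_mul]
  simp only [hamplitude, Matrix.mulVec, dotProduct, mobility, Matrix.of_apply, add_mul,
    Finset.sum_add_distrib, ite_mul, zero_mul, Finset.sum_ite_eq, Finset.mem_univ, if_true,
    mul_comm (scal _ _ _)]

theorem re_exp_mul_mobility_mulVec (r : Rates d N) (p : Torus d N → ℝ) (ω : ℝ) (v : Fin d → ℝ)
    (t : ℝ) (j : Fin d) :
    (Complex.exp (Complex.I * ω * t) * (mobility r p ω *ᵥ fun k => (v k : ℂ)) j).re =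
      ∑ x, (p x * (response r p ω v t x).re * gammaFun r j x +
        p x * (Real.cos (ω * t) * v j * cFun r j x)) := by
  have hscal : (Complex.exp (Complex.I * ω * t) *
      scal p (toC (gammaFun r j)) (amplitude r p ω v)).re =
        ∑ x, p x * (response r p ω v t x).re * gammaFun r j x := by
    rw [← smul_eq_mul, ← scalCLM_apply, ← map_smul, scalCLM_apply, re_scal]
    refine Finset.sum_congr rfl fun x _ => ?_
    rw [toC, Complex.conj_ofReal, Complex.re_ofReal_mul, response, rePart_apply, Complex.ofReal_re]
    ring
  rw [mobility_mulVec, mul_add, Complex.add_re, hscal, Finset.sum_add_distrib, add_comm,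
    ← Complex.ofReal_mul, Complex.re_mul_ofReal, re_exp_I_mul, Finset.sum_mul, Finset.mul_sum]
  exact congrArg _ (Finset.sum_congr rfl fun x _ => by ring)

theorem density_zero_eq_one {Ω : Type*} [MeasurableSpace Ω] {P : Measure Ω}
    [IsProbabilityMeasure P] {Y : ℝ≥0 → Ω → Fin d → ℤ} (hr : ∀ x e, 0 < r x e)
    (hp : IsInvariant r p) (hω : ω ≠ 0) (hY : IsOscillatorySteadyState r ω v 0 P Y) {t : ℝ}
    (ht : 0 ≤ t) : density p P Y t = 1 := by
  obtain ⟨κ, hκ, hgap⟩ := exists_hasSpectralGap (reversed_pos hr (hp.pos hr)) (hp.pos hr)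
  have h := norm_density_sub_one_le hgap hκ hr (hp.pos hr) hp hω hY (by simp) ht
  exact sub_eq_zero.1 (norm_le_zero_iff.1 (by simpa using h))

variable {Ω : ℝ → Type*} [∀ l, MeasurableSpace (Ω l)] {P : ∀ l, Measure (Ω l)}
  [∀ l, IsProbabilityMeasure (P l)] {Y : ∀ l, ℝ≥0 → Ω l → Fin d → ℤ}

theorem hasDerivAt_density (hr : ∀ x e, 0 < r x e) (hp : IsInvariant r p) (hω : ω ≠ 0)
    (hY : ∀ l, IsOscillatorySteadyState r ω v l (P l) (Y l)) {t : ℝ} (ht : 0 ≤ t) :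
    HasDerivAt (fun l => density p (P l) (Y l) t) (response r p ω v t) 0 := by
  have hp₀ := hp.pos hr
  obtain ⟨κ, hκ, hgap⟩ := exists_hasSpectralGap (reversed_pos hr hp₀) hp₀
  have hsmall : ∀ᶠ l : ℝ in 𝓝 0, |l| * ‖v‖ ≤ 1 := by
    have hcont : Continuous fun l : ℝ => |l| * ‖v‖ := by fun_prop
    exact hcont.continuousAt.eventually_le_const (by simp)
  refine hasDerivAt_of_eventually_norm_sub_le_sq (C := remainderConst r p κ * ‖v‖ ^ 2)
    (hsmall.mono fun l hl => ?_)
  rw [density_zero_eq_one hr hp hω (hY 0) ht, sub_zero, mul_right_comm, mul_assoc, ← sq_abs l,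
    ← mul_pow]
  exact norm_density_sub_response_le hgap hκ hr hp₀ hp hω (hY l) hl ht

theorem hasDerivAt_meanVelocity (hr : ∀ x e, 0 < r x e) (hp : IsInvariant r p) (hω : ω ≠ 0)
    (hY : ∀ l, IsOscillatorySteadyState r ω v l (P l) (Y l)) {t : ℝ} (ht : 0 ≤ t) :
    HasDerivAt (fun l => meanVelocity (P l) (Y l) t)
      (fun j => (Complex.exp (Complex.I * ω * t) *
        (mobility r p ω *ᵥ fun k => (v k : ℂ)) j).re) 0 := by
  have hlaw (x : Torus d N) : HasDerivAt (fun l => law N (P l) (Y l) t x)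
      (p x * (response r p ω v t x).re) 0 := by
    simp only [law_eq_mul_re_density (hp.pos hr)]
    exact (Complex.reCLM.hasFDerivAt.comp_hasDerivAt 0
      (hasDerivAt_pi.1 (hasDerivAt_density hr hp hω hY ht) x)).const_mul (p x)
  have hlaw₀ (x : Torus d N) : law N (P 0) (Y 0) t x = p x := by
    simp [law_eq_mul_re_density (hp.pos hr), density_zero_eq_one hr hp hω (hY 0) ht]
  refine hasDerivAt_pi.2 fun j => ?_
  have hperturbed₀ (x : Torus d N) : gammaFun (perturbed r ω v 0 t) j x = gammaFun r j x := by
    simp [gammaFun, perturbed]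
  simp only [fun l => (hY l).meanVelocity_apply ht j]
  refine (HasDerivAt.fun_sum fun x _ =>
    (hlaw x).mul (hasDerivAt_gammaFun_perturbed r ω v t j x)).congr_deriv ?_
  simp only [hlaw₀, hperturbed₀, re_exp_mul_mobility_mulVec]

end Derivative

/-! ### The reversible case -/

section Reversible

variable {r : Rates d N} {p : Torus d N → ℝ} {ω : ℝ}

theorem IsReversible.psiFun_eq (h : IsReversible r p) (k : Fin d) (x : Torus d N) :
    psiFun r p k x = -2 * gammaFun r k x := by
  rw [IsReversible] at h
  simp only [psiFun, h, add_mul, Finset.sum_add_distrib, sum_mul_vec]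
  ring

theorem IsReversible.toC_psiFun (h : IsReversible r p) (k : Fin d) :
    toC (psiFun r p k) = (-2 : ℂ) • toC (gammaFun r k) := by
  funext x
  simp [toC, h.psiFun_eq]

variable [NeZero N]

theorem IsReversible.adjGenerator_eq (h : IsReversible r p) : adjGenerator r p = generator r :=
  congrArg generator h

theorem IsReversible.mean_mul_generator_comm (h : IsReversible r p) (hp₀ : ∀ x, 0 < p x)
    (hp : IsInvariant r p) (f g : Torus d N → ℂ) :
    mean p (f * generator r g) = mean p (generator r f * g) := by
  rw [mean_mul_generator hp₀ hp, h]

theorem IsReversible.mean_mul_resolvent_comm (h : IsReversible r p) (hp₀ : ∀ x, 0 < p x)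
    (hp : IsInvariant r p) {z : ℂ} (hz : z ∈ resolventSet ℂ (generator r)) (f g : Torus d N → ℂ) :
    mean p (f * resolvent (generator r) z g) = mean p (resolvent (generator r) z f * g) := by
  set F := resolvent (generator r) z f
  set G := resolvent (generator r) z g
  have hsolve (w : Torus d N → ℂ) :
      w = z • resolvent (generator r) z w - generator r (resolvent (generator r) z w) := by
    have hw := sub_resolvent_apply hz w
    rw [sub_apply, Algebra.algebraMap_eq_smul_one] at hw
    exact hw.symm
  calc mean p (f * G) = mean p ((z • F - generator r F) * G) := by rw [← hsolve f]
    _ = mean p (F * (z • G - generator r G)) := by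
        rw [sub_mul, mul_sub, smul_mul_assoc, mul_smul_comm, map_sub, map_sub,
          h.mean_mul_generator_comm hp₀ hp]
    _ = mean p (F * g) := by rw [← hsolve g]

theorem IsReversible.scal_resolvent_comm (h : IsReversible r p) (hp₀ : ∀ x, 0 < p x)
    (hp : IsInvariant r p) {z : ℂ} (hz : z ∈ resolventSet ℂ (generator r)) (f g : Torus d N → ℝ) :
    scal p (toC f) (resolvent (generator r) z (toC g)) =
      scal p (toC g) (resolvent (generator r) z (toC f)) := by
  have hreal (f : Torus d N → ℝ) : star (toC f) = toC f := funext fun x => Complex.conj_ofReal _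
  rw [scal_eq_mean, scal_eq_mean, hreal, hreal, h.mean_mul_resolvent_comm hp₀ hp hz, mul_comm]

theorem IsReversible.mobility_apply (h : IsReversible r p) (ω : ℝ) (j k : Fin d) :
    mobility r p ω j k = (if j = k then ((∑ x, p x * cFun r j x : ℝ) : ℂ) else 0) -
      2 * scal p (toC (gammaFun r j))
        (resolvent (generator r) (Complex.I * (ω : ℂ)) (toC (gammaFun r k))) := by
  rw [mobility, Matrix.of_apply, h.toC_psiFun, h.adjGenerator_eq, map_smul, ← scalCLM_apply,
    map_smul, scalCLM_apply, smul_eq_mul, neg_mul, ← sub_eq_add_neg]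

theorem IsReversible.mobility_isSymm (h : IsReversible r p) (hr : ∀ x e, 0 < r x e)
    (hp : IsInvariant r p) (hω : ω ≠ 0) : (mobility r p ω).IsSymm := by
  have hz : Complex.I * (ω : ℂ) ∈ resolventSet ℂ (generator r) :=
    mem_resolventSet_generator hr (hp.pos hr) hp (by simp) (by simp [hω])
  refine Matrix.IsSymm.ext fun j k => ?_
  rw [h.mobility_apply, h.mobility_apply, h.scal_resolvent_comm (hp.pos hr) hp hz]
  obtain rfl | hjk := eq_or_ne j k
  · rfl
  · rw [if_neg hjk, if_neg hjk.symm]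

theorem IsReversible.mean_gammaFun (h : IsReversible r p) (hp₀ : ∀ x, 0 < p x) (k : Fin d) :
    mean p (toC (gammaFun r k)) = 0 := by
  have hpsi := mean_psiFun (r := r) hp₀ k
  rw [h.toC_psiFun, map_smul] at hpsi
  exact (smul_eq_zero.1 hpsi).resolve_left (by norm_num)

end Reversible

end TorusWalk

open TorusWalk in
theorem mainTheorem6_general (d N : ℕ) [NeZero N] (r : Rates d N) (hr : ∀ x e, 0 < r x e)
    (p : Torus d N → ℝ) (hp : IsInvariant r p) (ω : ℝ) (hω : ω ≠ 0) :
    (∀ (v : Fin d → ℝ) (Ω : ℝ → Type*) [∀ l, MeasurableSpace (Ω l)]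
        (P : ∀ l, Measure (Ω l)) [∀ l, IsProbabilityMeasure (P l)]
        (Y : ∀ l, ℝ≥0 → Ω l → Fin d → ℤ),
      (∀ l, IsOscillatorySteadyState r ω v l (P l) (Y l)) →
        (∀ l (t : ℝ), 0 ≤ t →
          (∀ j, Integrable (fun a => (Y l t.toNNReal a j : ℝ)) (P l)) ∧
          DifferentiableWithinAt ℝ (meanPosition (P l) (Y l)) (Ici 0) t ∧
          ∀ j, meanVelocity (P l) (Y l) t j =
            ∑ e : Direction d,
              (∫ a, perturbed r ω v l t (proj N (Y l t.toNNReal a)) e ∂(P l)) * (e.vec j : ℝ)) ∧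
        (∀ t : ℝ, 0 ≤ t →
          HasDerivAt (fun l => meanVelocity (P l) (Y l) t)
            (fun j => (Complex.exp (Complex.I * ω * t) *
              (mobility r p ω *ᵥ fun k => (v k : ℂ)) j).re) 0)) ∧
    Complex.I * (ω : ℂ) ∈ resolventSet ℂ (adjGenerator r p) ∧
    (∀ j k,
      IntegrableOn (laplaceIntegrand p (adjGenerator r p) ω (toC (gammaFun r j))
        (toC (psiFun r p k))) (Ioi 0) ∧
      mobility r p ω j k = (if j = k then ((∑ x, p x * cFun r j x : ℝ) : ℂ) else 0) +
        ∫ s in Ioi (0 : ℝ), laplaceIntegrand p (adjGenerator r p) ω (toC (gammaFun r j))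
          (toC (psiFun r p k)) s) ∧
    (IsReversible r p →
      (∀ k x, psiFun r p k x = -2 * gammaFun r k x) ∧
      adjGenerator r p = generator r ∧
      (mobility r p ω).IsSymm ∧
      (∀ j k,
        mobility r p ω j k = (if j = k then ((∑ x, p x * cFun r j x : ℝ) : ℂ) else 0) -
          2 * scal p (toC (gammaFun r j))
            (resolvent (generator r) (Complex.I * (ω : ℂ)) (toC (gammaFun r k))) ∧
        IntegrableOn (laplaceIntegrand p (generator r) ω (toC (gammaFun r j))
          (toC (gammaFun r k))) (Ioi 0) ∧
        mobility r p ω j k = (if j = k then ((∑ x, p x * cFun r j x : ℝ) : ℂ) else 0) -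
          2 * ∫ s in Ioi (0 : ℝ), laplaceIntegrand p (generator r) ω (toC (gammaFun r j))
            (toC (gammaFun r k)) s)) := by
  have hp₀ := hp.pos hr
  refine ⟨fun v Ω _ P _ Y hY => ⟨fun l t ht => ⟨fun j => (hY l).integrable t.toNNReal j,
    ((hY l).hasDerivWithinAt_meanPosition ht).differentiableWithinAt,
    fun j => (hY l).meanVelocity_eq_sum_integral ht j⟩,
    fun t ht => hasDerivAt_meanVelocity hr hp hω hY ht⟩,
    mem_resolventSet_adjGenerator hr hp₀ hp hω, fun j k => ?_, fun hrev =>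
    ⟨hrev.psiFun_eq, hrev.adjGenerator_eq, hrev.mobility_isSymm hr hp hω, fun j k => ?_⟩⟩
  · obtain ⟨hint, hlaplace⟩ := laplace_resolvent (reversed_pos hr hp₀) hp₀ (hp.reversed hp₀) hω
      (toC (gammaFun r j)) (mean_psiFun (r := r) hp₀ k)
    exact ⟨hint, congrArg (_ + ·) hlaplace⟩
  · obtain ⟨hint, hlaplace⟩ := laplace_resolvent hr hp₀ hp hω
      (toC (gammaFun r j)) (hrev.mean_gammaFun hp₀ k)
    exact ⟨hrev.mobility_apply ω j k, hint, hlaplace ▸ hrev.mobility_apply ω j k⟩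

theorem mainTheorem6 (d N : ℕ) [NeZero N]
    (r : TorusWalk.Rates d N) (hr : ∀ x e, 0 < r x e)
    (p : TorusWalk.Torus d N → ℝ) (hp : TorusWalk.IsInvariant r p)
    (ω : ℝ) (hω : ω ≠ 0) :
    -- linear response of the mean velocity in the oscillatory steady state
    (∀ v : Fin d → ℝ, ∑ i, v i ^ 2 = 1 →
      ∀ (Ω : ℝ → Type*) [∀ l, MeasurableSpace (Ω l)]
        (P : ∀ l, Measure (Ω l)) [∀ l, IsProbabilityMeasure (P l)]
        (Y : ∀ l, ℝ≥0 → Ω l → Fin d → ℤ),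
      (∀ l, TorusWalk.IsOscillatorySteadyState r ω v l (P l) (Y l)) →
        (∀ l (t : ℝ), 0 ≤ t →
          (∀ j, Integrable (fun a => (Y l t.toNNReal a j : ℝ)) (P l)) ∧
          DifferentiableWithinAt ℝ (TorusWalk.meanPosition (P l) (Y l)) (Ici 0) t ∧
          ∀ j, TorusWalk.meanVelocity (P l) (Y l) t j =
            ∑ e : TorusWalk.Direction d,
              (∫ a, TorusWalk.perturbed r ω v l t
                (TorusWalk.proj N (Y l t.toNNReal a)) e ∂(P l)) * (e.vec j : ℝ)) ∧
        (∀ t : ℝ, 0 ≤ t →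
          HasDerivAt (fun l => TorusWalk.meanVelocity (P l) (Y l) t)
            (fun j => (Complex.exp (Complex.I * ω * t) *
              (TorusWalk.mobility r p ω *ᵥ fun k => (v k : ℂ)) j).re) 0)) ∧
    -- the operator `iω - L*` is invertible, and the integral form of the mobility matrix
    (Complex.I * (ω : ℂ) ∈ resolventSet ℂ (TorusWalk.adjGenerator r p)) ∧
    (∀ j k,
      IntegrableOn (TorusWalk.laplaceIntegrand p (TorusWalk.adjGenerator r p) ω
        (TorusWalk.toC (TorusWalk.gammaFun r j)) (TorusWalk.toC (TorusWalk.psiFun r p k)))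
        (Ioi 0) ∧
      TorusWalk.mobility r p ω j k =
        (if j = k then ((∑ x, p x * TorusWalk.cFun r j x : ℝ) : ℂ) else 0) +
          ∫ s in Ioi (0 : ℝ), TorusWalk.laplaceIntegrand p (TorusWalk.adjGenerator r p) ω
            (TorusWalk.toC (TorusWalk.gammaFun r j))
            (TorusWalk.toC (TorusWalk.psiFun r p k)) s) ∧
    -- the reversible case
    (TorusWalk.IsReversible r p →
      (∀ k x, TorusWalk.psiFun r p k x = -2 * TorusWalk.gammaFun r k x) ∧
      TorusWalk.adjGenerator r p = TorusWalk.generator r ∧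
      (TorusWalk.mobility r p ω).IsSymm ∧
      (∀ j k,
        TorusWalk.mobility r p ω j k =
          (if j = k then ((∑ x, p x * TorusWalk.cFun r j x : ℝ) : ℂ) else 0) -
            2 * TorusWalk.scal p (TorusWalk.toC (TorusWalk.gammaFun r j))
              (resolvent (TorusWalk.generator r) (Complex.I * (ω : ℂ))
                (TorusWalk.toC (TorusWalk.gammaFun r k))) ∧
        IntegrableOn (TorusWalk.laplaceIntegrand p (TorusWalk.generator r) ω
          (TorusWalk.toC (TorusWalk.gammaFun r j)) (TorusWalk.toC (TorusWalk.gammaFun r k)))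
          (Ioi 0) ∧
        TorusWalk.mobility r p ω j k =
          (if j = k then ((∑ x, p x * TorusWalk.cFun r j x : ℝ) : ℂ) else 0) -
            2 * ∫ s in Ioi (0 : ℝ), TorusWalk.laplaceIntegrand p (TorusWalk.generator r) ω
              (TorusWalk.toC (TorusWalk.gammaFun r j))
              (TorusWalk.toC (TorusWalk.gammaFun r k)) s)) := by
  have h := mainTheorem6_general d N r hr p hp ω hω
  exact ⟨fun v _ => h.1 v, h.2⟩
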